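/- All multigraphs are finite and loopless. For a multigraph $G$, let $e_G(u,v)$ be the number of edges joining $u$ and $v$, let $\Delta(G)$ be the maximum degree, and let $\mu(G)=\max_{u,v\in V(G)} e_G(u,v)$. A $k$-edge-coloring of $G$ is an assignment of colors from $\{1,\dots,k\}$ to the edges such that distinct edges sharing an end get different colors. For $J\subseteq E(G)$, $G[J]$ is the subgraph formed by the edges of $J$, and $G-J$ is obtained from $G$ by deleting the edges of $J$. Let $G$ be a multigraph with $\mu(G)\le 2$, let $x\in V(G)$, and suppose that for every vertex $u\ne x$ there is at most one vertex $v\in V(G)$ with $e_G(u,v)=2$. Let $J_0\subseteq E(G)$ be the union of the set of all edges of $G$ incident with $x$ and of a matching $M$ of $G$, no edge of which is incident with $x$. Let $J_0\subseteq J\subseteq E(G)$ be such that $G-J$ is simple, and suppose that for some integer $k_0$ with $|J_0|\le k_0\le\Delta(G)$ the multigraph $G[J]$ has a $k_0$-edge-coloring in which the edges of $J_0$ receive pairwise different colors. Then the following hold. (a) For every $k\ge\Delta(G)+4$, $G$ has a $k$-edge-coloring in which the edges of $J_0$ receive pairwise different colors. (b) Suppose in addition that every vertex $u\neq x$ is incident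 with at most one edge of $J_0$ (that is, $x$ is on no pair of parallel edges, and no edge of $M$ has an end adjacent to $x$). If $G-x$ is simple and bipartite with bipartition $(X,Y)$, if $\Delta(G[J]-x)\le 1$, and if $k\ge\Delta(G)$ is an integer such that every vertex of $X$ has degree less than $k$ in $G$, then $G$ has a $k$-edge-coloring in which the edges of $J_0$ receive pairwise different colors. -/

import Mathlib

namespace Graph

/-- The degree of `v`: the number of edges incident with `v`. (All multigraphs considered are
loopless, so that no edge has to be counted twice.) -/
noncomputable def degree {α β : Type*} (G : Graph α β) (v : α) : ℕ :=
  {e | G.Inc e v}.ncard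

/-- The maximum degree `Δ(G)` of a finite multigraph (`0` if there are no vertices). -/
noncomputable def maxDegree {α β : Type*} (G : Graph α β) : ℕ :=
  sSup (G.degree '' G.vertexSet)

/-- `e_G(u, v)`: the number of edges with ends `u` and `v`. -/
noncomputable def edgeCount {α β : Type*} (G : Graph α β) (u v : α) : ℕ :=
  {e | G.IsLink e u v}.ncard

/-- The multiplicity of a vertex, `μ_G(v) = max {e_G(u, v) : u ∈ V(G)}`. -/
noncomputable def vertexMultiplicity {α β : Type*} (G : Graph α β) (v : α) : ℕ :=
  sSup ((fun u => G.edgeCount u v) '' G.vertexSet)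

/-- The multiplicity of a finite multigraph, `μ(G) = max {μ_G(v) : v ∈ V(G)}`. -/
noncomputable def multiplicity {α β : Type*} (G : Graph α β) : ℕ :=
  sSup (G.vertexMultiplicity '' G.vertexSet)

/-- `M` is a matching of `G`: a set of edges no two of which share an end. -/
def IsEdgeMatching {α β : Type*} (G : Graph α β) (M : Set β) : Prop :=
  M ⊆ G.edgeSet ∧ ∀ e ∈ M, ∀ f ∈ M, ∀ v, G.Inc e v → G.Inc f v → e = f

/-- `φ` is a (proper) `k`-edge-coloring of `G`: every edge of `G` has a color in `{1, …, k}`, and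
distinct edges sharing an end have different colors. Values of `φ` outside `E(G)` are
irrelevant. -/
def IsEdgeColoring {α β : Type*} (G : Graph α β) (k : ℕ) (φ : β → ℕ) : Prop :=
  (∀ e ∈ G.edgeSet, φ e ∈ Set.Icc 1 k) ∧
    ∀ e ∈ G.edgeSet, ∀ f ∈ G.edgeSet, ∀ v, G.Inc e v → G.Inc f v → e ≠ f → φ e ≠ φ f

/-- `(X, Y)` is a bipartition of `G`: the sets `X` and `Y` partition `V(G)`, and every edge has one
end in `X` and the other in `Y`. -/
def IsBipartition {α β : Type*} (G : Graph α β) (X Y : Set α) : Prop :=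
  X ∪ Y = G.vertexSet ∧ Disjoint X Y ∧
    ∀ e u v, G.IsLink e u v → (u ∈ X ∧ v ∈ Y) ∨ (u ∈ Y ∧ v ∈ X)

end Graph

/-!
Vizing's fan argument, carried out so that the edges of `J₀` keep pairwise different colors.

Among all proper partial colorings with colors `1, …, k` in which `J₀` is colored and rainbow, take
one with the fewest uncolored edges (`IsOptimal`). Such colorings exist because `G[J]` is colored.
Suppose that `e` is uncolored. As `J₀` is colored, `e ∉ J₀`. Fix an end `v` of `e`, the center, and
a set `A ∋ e` of pairwise nonparallel edges at `v` outside `J₀`; the fan consists of the edges of `A`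
reached from `e` by passing from `f` to an edge whose color is missing at the far end of `f`.
Colors can be moved along the fan (`exists_shift`), so no color is missing both at `v` and at the
far end of a fan edge. Every color missing at a far end is thus the color of a fan edge or of an edge
outside `A`, and one counts how often a color can be missing.

A Kempe change on a component `C` of the colors `a`, `b` keeps `J₀` rainbow unless `C` meets exactly
one of the at most two edges of `J₀` with these colors. If the change is admissible and `a` is missing
at `v`, then `C` contains either both or none of `v` and a far end that misses `b`
(`mem_iff_farEnd_mem`). On the other hand a component, being a path or a cycle, misses at most two of
the colors `a` and `b` in total (`ncard_missing_kempeComponent_le`).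

In part (b), `A` leaves out at most one edge at `v`, where `v ∈ Y`. If two far ends miss `b`, then the
change on the component of `v` cannot be admissible, whence `x` misses `a` or `b`. Bipartiteness then
puts `v` and the two far ends into three different components. One of these meets no edge of `J₀`
with color `a` or `b`, so the change on it is admissible and separates `v` from a far end, a
contradiction. Hence no color is missing at two far ends, while each far end lies in `X` and misses
a color, that of `e` two; this is too many (`false_of_bipartite`).

In part (a), `A` leaves out at most three edges at `v`, far ends miss at least four colors, and some
color `d` is absent from `J₀`. Changes that involve `d` are always admissible. So `d` is not
missing at `v`, since otherwise each color would be missing at only one far end; the same follows for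
all far ends, as each can be made a center. If a far end misses `b` and its `b`-`d` component
avoids the edge of `J₀` colored `b`, then the change there makes it miss `d`, which is absurd as long as
the change preserves the fan. Consequently `b` is missing at no more than two far ends if no
fan edge has color `b`, no more than four in general, and no more than three if `b` is missing at
the far end of `e`. There are at least two fan edges of the last kind, and with these bounds the
count fails (`false_of_hasFanDomains`).
-/

namespace Graph

variable {α β : Type*} {G : Graph α β} {J₀ J M A : Set β} {k a b c d : ℕ} {φ ψ : β → ℕ}
  {e f g : β} {u v w x : α} {S : Set α} {B : Set ℕ}

/-! ### Rainbow partial colorings -/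

/-- A proper partial edge coloring of `G` with colors in `{1, …, k}`, the value `0` standing for
an uncolored edge, in which the edges of `J₀` are colored with pairwise different colors. -/
structure IsRainbowPartial (G : Graph α β) (J₀ : Set β) (k : ℕ) (φ : β → ℕ) : Prop where
  le : ∀ e ∈ G.edgeSet, φ e ≤ k
  proper : ∀ ⦃e f v⦄, G.Inc e v → G.Inc f v → φ e = φ f → φ e ≠ 0 → e = f
  colored : ∀ e ∈ J₀, φ e ≠ 0
  injOn : Set.InjOn φ J₀

/-- The edges of `G` that are left uncolored (have color `0`). -/
def uncolored (G : Graph α β) (φ : β → ℕ) : Set β := {e | e ∈ G.edgeSet ∧ φ e = 0}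

/-- A rainbow partial coloring with as few uncolored edges as possible. -/
structure IsOptimal (G : Graph α β) (J₀ : Set β) (k : ℕ) (φ : β → ℕ) : Prop extends
    IsRainbowPartial G J₀ k φ where
  ncard_le : ∀ ψ, IsRainbowPartial G J₀ k ψ → (G.uncolored φ).ncard ≤ (G.uncolored ψ).ncard

open Classical in
/-- The colors of `{1, …, k}` that appear on no edge at `v`. -/
noncomputable def missing (G : Graph α β) (k : ℕ) (φ : β → ℕ) (v : α) : Finset ℕ :=
  {c ∈ Finset.Icc 1 k | ∀ e, G.Inc e v → φ e ≠ c}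

lemma mem_missing : c ∈ G.missing k φ v ↔ c ∈ Set.Icc 1 k ∧ ∀ e, G.Inc e v → φ e ≠ c := by
  classical simp [missing]

lemma ne_zero_of_mem_missing (h : c ∈ G.missing k φ v) : c ≠ 0 := by
  have := (mem_missing.1 h).1.1
  omega

lemma le_card_missing_add_ncard (hE : G.edgeSet.Finite) (s : Set β)
    (hs : ∀ e, G.Inc e v → φ e ≠ 0 → e ∈ s) (hsE : s ⊆ G.edgeSet) :
    k ≤ (G.missing k φ v).card + s.ncard := by
  classical
  have hsf : s.Finite := hE.subset hsE
  have h1 : Finset.Icc 1 k ⊆ G.missing k φ v ∪ hsf.toFinset.image φ := by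
    intro c hc
    by_cases h : c ∈ G.missing k φ v
    · exact Finset.mem_union_left _ h
    · have hc' : c ∈ Set.Icc 1 k := by simpa using hc
      rw [mem_missing] at h
      push Not at h
      obtain ⟨e, he, hec⟩ := h hc'
      refine Finset.mem_union_right _ (Finset.mem_image.2 ⟨e, ?_, hec⟩)
      rw [Set.Finite.mem_toFinset]
      exact hs e he (by rw [hec]; have := hc'.1; omega)
  have h2 := (Finset.card_le_card h1).trans (Finset.card_union_le _ _)
  have h3 : (hsf.toFinset.image φ).card ≤ hsf.toFinset.card := Finset.card_image_le
  rw [Set.ncard_eq_toFinset_card s hsf]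
  simp at h2
  omega

lemma le_card_missing_add_degree (hE : G.edgeSet.Finite) (φ : β → ℕ) (v : α) :
    k ≤ (G.missing k φ v).card + G.degree v :=
  le_card_missing_add_ncard hE _ (fun _ h _ => h) (fun _ h => h.edge_mem)

lemma lt_card_missing_add_degree (hE : G.edgeSet.Finite) (he : G.Inc e v) (h0 : φ e = 0) :
    k < (G.missing k φ v).card + G.degree v := by
  have hf : {e | G.Inc e v}.Finite := hE.subset fun _ h => h.edge_mem
  have h1 := le_card_missing_add_ncard (k := k) (φ := φ) (v := v) hE ({e | G.Inc e v} \ {e})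
    (fun f hf hf0 => ⟨hf, fun h => hf0 (h ▸ h0)⟩) (fun _ h => h.1.edge_mem)
  have h2 : ({e | G.Inc e v} \ {e}).ncard + 1 = G.degree v :=
    Set.ncard_sdiff_singleton_add_one (s := {e | G.Inc e v}) he hf
  omega

lemma IsOptimal.disjoint_missing (h : IsOptimal G J₀ k φ) (hE : G.edgeSet.Finite)
    (he : G.IsLink e v w) (h0 : φ e = 0) (hv : c ∈ G.missing k φ v) : c ∉ G.missing k φ w := by
  classical
  intro hw
  have hc0 := ne_zero_of_mem_missing hv
  rw [mem_missing] at hv hw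
  have key : ∀ f u, G.Inc e u → G.Inc f u → φ f ≠ c := by
    intro f u hu hf
    rcases hu.eq_or_eq_of_isLink he with rfl | rfl
    · exact hv.2 f hf
    · exact hw.2 f hf
  have hR : IsRainbowPartial G J₀ k (Function.update φ e c) := by
    refine ⟨fun f hf => ?_, fun f g u hf hg hfg hf0 => ?_, fun f hf => ?_, ?_⟩
    · by_cases hfe : f = e
      · subst hfe; simpa using hv.1.2
      · simpa [hfe] using h.le f hf
    · by_cases hfe : f = e <;> by_cases hge : g = e
      · rw [hfe, hge]
      · subst hfe
        exact absurd (by simpa [hge] using hfg.symm) (key g u hf hg)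
      · subst hge
        exact absurd (by simpa [hfe] using hfg) (key f u hg hf)
      · simp only [Function.update_of_ne hfe, Function.update_of_ne hge] at hfg hf0
        exact h.proper hf hg hfg hf0
    · by_cases hfe : f = e
      · subst hfe; simpa using hc0
      · simpa [hfe] using h.colored f hf
    · have heJ : e ∉ J₀ := fun hJ => h.colored e hJ h0
      intro f hf g hg hfg
      rw [Function.update_of_ne (by rintro rfl; exact heJ hf),
        Function.update_of_ne (by rintro rfl; exact heJ hg)] at hfg
      exact h.injOn hf hg hfg
  have h1 := h.ncard_le _ hR
  have h2 : G.uncolored (Function.update φ e c) ⊆ G.uncolored φ \ {e} := by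
    rintro f ⟨hf, hf0⟩
    have hfe : f ≠ e := by rintro rfl; simp at hf0; exact hc0 hf0
    exact ⟨⟨hf, by simpa [hfe] using hf0⟩, hfe⟩
  have hfin : (G.uncolored φ).Finite := hE.subset fun _ h => h.1
  have h3 := Set.ncard_le_ncard h2 (hfin.subset Set.sdiff_subset)
  have h4 := Set.ncard_sdiff_singleton_lt_of_mem (s := G.uncolored φ) ⟨he.edge_mem, h0⟩ hfin
  omega

/-! ### Kempe changes -/

/-- No edge of color `a` or `b` leaves the vertex set `S`. -/
def KempeClosed (G : Graph α β) (φ : β → ℕ) (a b : ℕ) (S : Set α) : Prop :=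
  ∀ ⦃e u v⦄, G.IsLink e u v → φ e = a ∨ φ e = b → u ∈ S → v ∈ S

open Classical in
/-- Interchange the colors `a` and `b` on all edges that meet `S`. -/
noncomputable def kempeSwap (G : Graph α β) (φ : β → ℕ) (a b : ℕ) (S : Set α) : β → ℕ :=
  fun e => if ∃ v ∈ S, G.Inc e v then Equiv.swap a b (φ e) else φ e

lemma kempeSwap_of_mem (he : G.Inc e v) (hv : v ∈ S) :
    G.kempeSwap φ a b S e = Equiv.swap a b (φ e) := if_pos ⟨v, hv, he⟩

lemma kempeSwap_of_ne (ha : φ e ≠ a) (hb : φ e ≠ b) : G.kempeSwap φ a b S e = φ e := by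
  unfold kempeSwap
  split_ifs
  · exact Equiv.swap_apply_of_ne_of_ne ha hb
  · rfl

lemma kempeSwap_of_forall_notMem (h : ∀ v ∈ S, ¬ G.Inc e v) : G.kempeSwap φ a b S e = φ e :=
  if_neg (by simpa using h)

lemma KempeClosed.kempeSwap_of_notMem (h : KempeClosed G φ a b S) (he : G.Inc e v) (hv : v ∉ S) :
    G.kempeSwap φ a b S e = φ e := by
  by_cases hab : φ e = a ∨ φ e = b
  · refine kempeSwap_of_forall_notMem fun u hu heu => hv ?_
    obtain ⟨y, hy⟩ := he
    rcases heu.eq_or_eq_of_isLink hy with rfl | rfl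
    · exact hu
    · exact h hy.symm hab hu
  · push Not at hab
    exact kempeSwap_of_ne hab.1 hab.2

lemma kempeSwap_eq_zero_iff (ha : a ≠ 0) (hb : b ≠ 0) :
    G.kempeSwap φ a b S e = 0 ↔ φ e = 0 := by
  unfold kempeSwap
  split_ifs
  · rw [Equiv.swap_apply_eq_iff, Equiv.swap_apply_of_ne_of_ne ha.symm hb.symm]
  · rfl

lemma KempeClosed.mem_missing_kempeSwap_of_notMem (h : KempeClosed G φ a b S) (hv : v ∉ S) :
    c ∈ G.missing k (G.kempeSwap φ a b S) v ↔ c ∈ G.missing k φ v := by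
  simp only [mem_missing]
  refine and_congr_right fun _ => forall₂_congr fun e he => ?_
  rw [h.kempeSwap_of_notMem he hv]

lemma mem_missing_kempeSwap (hv : v ∈ S) (ha : a ∈ Set.Icc 1 k) (hb : b ∈ Set.Icc 1 k) :
    c ∈ G.missing k (G.kempeSwap φ a b S) v ↔ Equiv.swap a b c ∈ G.missing k φ v := by
  simp only [mem_missing]
  refine and_congr ?_ (forall₂_congr fun e he => ?_)
  · rcases eq_or_ne c a with rfl | hca
    · simp only [Equiv.swap_apply_left, ha, hb]
    rcases eq_or_ne c b with rfl | hcb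
    · simp only [Equiv.swap_apply_right, ha, hb]
    rw [Equiv.swap_apply_of_ne_of_ne hca hcb]
  · rw [kempeSwap_of_mem he hv, Ne, Equiv.swap_apply_eq_iff]

lemma IsOptimal.kempeSwap (h : IsOptimal G J₀ k φ) (hS : KempeClosed G φ a b S)
    (ha : a ∈ Set.Icc 1 k) (hb : b ∈ Set.Icc 1 k)
    (hinj : Set.InjOn (G.kempeSwap φ a b S) J₀) : IsOptimal G J₀ k (G.kempeSwap φ a b S) := by
  have ha0 : a ≠ 0 := by have := ha.1; omega
  have hb0 : b ≠ 0 := by have := hb.1; omega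
  have hU : G.uncolored (G.kempeSwap φ a b S) = G.uncolored φ := by
    ext e; simp [uncolored, kempeSwap_eq_zero_iff ha0 hb0]
  refine ⟨⟨fun e he => ?_, fun e f v he hf hef he0 => ?_, fun e he => ?_, hinj⟩, ?_⟩
  · by_cases hab : φ e = a ∨ φ e = b
    · unfold Graph.kempeSwap
      split_ifs
      · rcases hab with hab | hab <;> rw [hab]
        · rw [Equiv.swap_apply_left]; exact hb.2
        · rw [Equiv.swap_apply_right]; exact ha.2
      · exact h.le e he
    · push Not at hab
      rw [kempeSwap_of_ne hab.1 hab.2]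
      exact h.le e he
  · rw [Ne, kempeSwap_eq_zero_iff ha0 hb0] at he0
    by_cases hv : v ∈ S
    · rw [kempeSwap_of_mem he hv, kempeSwap_of_mem hf hv] at hef
      exact h.proper he hf ((Equiv.swap a b).injective hef) he0
    · rw [hS.kempeSwap_of_notMem he hv, hS.kempeSwap_of_notMem hf hv] at hef
      exact h.proper he hf hef he0
  · rw [Ne, kempeSwap_eq_zero_iff ha0 hb0]
    exact h.colored e he
  · intro ψ hψ
    rw [hU]
    exact h.ncard_le ψ hψ

/-- The simple graph formed by the pairs of vertices joined by an edge of color `a` or `b`. -/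
def kempeGraph (G : Graph α β) (φ : β → ℕ) (a b : ℕ) : SimpleGraph α where
  Adj u v := u ≠ v ∧ ∃ e, G.IsLink e u v ∧ (φ e = a ∨ φ e = b)
  symm := ⟨fun _ _ ⟨h, e, he, hab⟩ => ⟨h.symm, e, he.symm, hab⟩⟩
  loopless := ⟨fun _ h => h.1 rfl⟩

/-- The vertex set of the component of `u` in the subgraph of the edges colored `a` or `b`. -/
def kempeComponent (G : Graph α β) (φ : β → ℕ) (a b : ℕ) (u : α) : Set α :=
  {v | (G.kempeGraph φ a b).Reachable u v}

lemma mem_kempeComponent_self : u ∈ G.kempeComponent φ a b u := SimpleGraph.Reachable.refl _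

lemma kempeComponent_eq_of_mem (h : v ∈ G.kempeComponent φ a b u) :
    G.kempeComponent φ a b v = G.kempeComponent φ a b u := by
  ext w
  exact ⟨fun hw => SimpleGraph.Reachable.trans h hw,
    fun hw => SimpleGraph.Reachable.trans (SimpleGraph.Reachable.symm h) hw⟩

lemma kempeClosed_kempeComponent (φ : β → ℕ) (a b : ℕ) (u : α) :
    KempeClosed G φ a b (G.kempeComponent φ a b u) := by
  intro e v w he hab hv
  by_cases hvw : v = w
  · exact hvw ▸ hv
  · exact SimpleGraph.Reachable.trans hv (SimpleGraph.Adj.reachable ⟨hvw, e, he, hab⟩)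

lemma kempeComponent_subset (h : u ∈ G.vertexSet) : G.kempeComponent φ a b u ⊆ G.vertexSet := by
  intro v hv
  obtain ⟨p⟩ := hv
  induction p with
  | nil => exact h
  | cons hadj p ih => exact ih hadj.2.choose_spec.1.right_mem

/-- A component of the subgraph of two color classes is a path or a cycle, so its vertices miss at
most two of these colors in total. -/
lemma ncard_missing_kempeComponent_le (hV : G.vertexSet.Finite) (h : IsRainbowPartial G J₀ k φ)
    (hu : u ∈ G.vertexSet) (ha : a ≠ 0) (hb : b ≠ 0) :
    {v | v ∈ G.kempeComponent φ a b u ∧ a ∈ G.missing k φ v}.ncard +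
      {v | v ∈ G.kempeComponent φ a b u ∧ b ∈ G.missing k φ v}.ncard ≤ 2 := by
  classical
  set H := G.kempeGraph φ a b with hH
  set C := H.connectedComponentMk u with hC
  have hmem : ∀ v, v ∈ C.supp ↔ v ∈ G.kempeComponent φ a b u := by
    intro v
    rw [SimpleGraph.ConnectedComponent.mem_supp_iff, hC, SimpleGraph.ConnectedComponent.eq]
    exact ⟨fun h => h.symm, fun h => SimpleGraph.Reachable.symm h⟩
  have hfin : C.supp.Finite :=
    hV.subset fun v hv => kempeComponent_subset hu ((hmem v).1 hv)
  have : Fintype C := hfin.fintype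
  have hconn := C.connected_toSimpleGraph
  have hcard := hconn.card_vert_le_card_edgeSet_add_one
  have hdeg : ∀ v : C, C.toSimpleGraph.degree v + ((if a ∈ G.missing k φ v then 1 else 0) +
      (if b ∈ G.missing k φ v then 1 else 0)) ≤ 2 := by
    intro v
    have key : ∀ c, c ≠ 0 → ({n : C | ∃ e, G.IsLink e v n ∧ φ e = c} : Finset C).card +
        (if c ∈ G.missing k φ v then 1 else 0) ≤ 1 := by
      intro c hc
      split_ifs with hm
      · rw [Finset.card_eq_zero.2]
        refine Finset.filter_eq_empty_iff.2 ?_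
        rintro n - ⟨e, he, hec⟩
        exact (mem_missing.1 hm).2 e he.inc_left hec
      · refine Finset.card_le_one.2 fun n hn m hm => ?_
        simp only [Finset.mem_filter, Finset.mem_univ, true_and] at hn hm
        obtain ⟨e, he, hec⟩ := hn
        obtain ⟨f, hf, hfc⟩ := hm
        obtain rfl := h.proper he.inc_left hf.inc_left (hec.trans hfc.symm) (hec ▸ hc)
        exact Subtype.ext (he.right_unique hf)
    have hsub : C.toSimpleGraph.neighborFinset v ⊆
        ({n : C | ∃ e, G.IsLink e v n ∧ φ e = a} : Finset C) ∪
        ({n : C | ∃ e, G.IsLink e v n ∧ φ e = b} : Finset C) := by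
      intro n hn
      rw [SimpleGraph.mem_neighborFinset] at hn
      obtain ⟨-, e, he, hab⟩ : H.Adj v n := hn
      rcases hab with hab | hab
      · exact Finset.mem_union_left _ (by simpa using ⟨e, he, hab⟩)
      · exact Finset.mem_union_right _ (by simpa using ⟨e, he, hab⟩)
    have h1 := (Finset.card_le_card hsub).trans (Finset.card_union_le _ _)
    rw [SimpleGraph.card_neighborFinset_eq_degree] at h1
    have h2 := key a ha
    have h3 := key b hb
    omega
  have hsum := Finset.sum_le_sum fun (v : C) (_ : v ∈ Finset.univ) => hdeg v
  rw [Finset.sum_add_distrib, Finset.sum_add_distrib, SimpleGraph.sum_degrees_eq_twice_card_edges]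
    at hsum
  have hcnt : ∀ c, {v | v ∈ G.kempeComponent φ a b u ∧ c ∈ G.missing k φ v}.ncard =
      ∑ v : C, if c ∈ G.missing k φ v then 1 else 0 := by
    intro c
    rw [← Finset.card_filter, ← Set.ncard_coe_finset,
      ← Set.ncard_image_of_injective _ (Subtype.val_injective (p := fun v => v ∈ C.supp))]
    congr 1
    ext v
    simp only [Set.mem_ofPred_eq, Finset.coe_filter, Finset.mem_univ, true_and, Set.mem_image,
      Subtype.exists, exists_and_right, exists_eq_right, hmem]
    exact ⟨fun h => ⟨h.1, h.2⟩, fun ⟨h1, h2⟩ => ⟨h1, h2⟩⟩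
  rw [hcnt, hcnt]
  rw [Nat.card_eq_fintype_card, Nat.card_eq_fintype_card, ← SimpleGraph.edgeFinset_card] at hcard
  simp only [Finset.sum_const, smul_eq_mul, Finset.card_univ] at hsum
  omega

/-! ### Fans -/

/-- A set `A` of edges at `v` that a fan with center `v` may use: it contains no edge of `J₀` and no
two parallel edges. -/
structure IsFanDomain (G : Graph α β) (J₀ : Set β) (v : α) (A : Set β) : Prop where
  inc : ∀ e ∈ A, G.Inc e v
  notMem : ∀ e ∈ A, e ∉ J₀
  simple : ∀ e ∈ A, ∀ f ∈ A, ∀ w, G.IsLink e v w → G.IsLink f v w → e = f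

open Classical in
/-- The end of the edge `f` other than `v`; the junk value is `v` if `f` is not incident
with `v`. -/
noncomputable def farEnd (G : Graph α β) (v : α) (f : β) : α :=
  if h : G.Inc f v then h.other else v

lemma Inc.isLink_farEnd (h : G.Inc f v) : G.IsLink f v (G.farEnd v f) := by
  rw [farEnd, dif_pos h]
  exact h.isLink_other

lemma IsFanDomain.injOn_farEnd (hA : IsFanDomain G J₀ v A) : Set.InjOn (G.farEnd v) A :=
  fun f hf g hg hfg => hA.simple f hf g hg _ (hA.inc f hf).isLink_farEnd
    (hfg ▸ (hA.inc g hg).isLink_farEnd)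

/-- A fan with center `v` may be continued from the edge `f` by the edge `g ∈ A` if the color of `g`
is missing at the far end of `f`; the colors in `B` are not to be used. -/
def FanStep (G : Graph α β) (k : ℕ) (φ : β → ℕ) (v : α) (A : Set β) (B : Set ℕ) (f g : β) : Prop :=
  g ∈ A ∧ φ g ∉ B ∧ φ g ∈ G.missing k φ (G.farEnd v f)

/-- The edge `f` lies in the fan with center `v` that starts with `e`. -/
def FanReach (G : Graph α β) (k : ℕ) (φ : β → ℕ) (v : α) (A : Set β) (B : Set ℕ) : β → β → Prop :=
  Relation.ReflTransGen (G.FanStep k φ v A B)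

lemma FanReach.mem (h : G.FanReach k φ v A B e f) (he : e ∈ A) : f ∈ A := by
  induction h with
  | refl => exact he
  | tail _ h _ => exact h.1

/-- An edge in the fan that starts with `e` either can be reached without the color of a given
edge `g` at `v`, or can be so reached from `g`. -/
lemma FanReach.or_of_mem (h : G.FanReach k φ v A B e f) (hφ : IsRainbowPartial G J₀ k φ)
    (hA : IsFanDomain G J₀ v A) (hg : g ∈ A) (hg0 : φ g ≠ 0) :
    G.FanReach k φ v A (insert (φ g) B) e f ∨ G.FanReach k φ v A (insert (φ g) B) g f := by
  induction h with
  | refl => exact .inl .refl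
  | @tail f f' _ hs ih =>
    by_cases hfg : φ f' = φ g
    · obtain rfl := hφ.proper (hA.inc _ hg) (hA.inc _ hs.1) hfg.symm hg0
      exact .inr .refl
    · have hs' : G.FanStep k φ v A (insert (φ g) B) f f' := ⟨hs.1, by simp [hfg, hs.2.1], hs.2.2⟩
      exact ih.imp (fun h => h.tail hs') (fun h => h.tail hs')

open Classical in
/-- Move the color of `g` to the edge `e`, leaving `g` uncolored. -/
noncomputable def shift (φ : β → ℕ) (e g : β) : β → ℕ :=
  Function.update (Function.update φ e (φ g)) g 0

lemma shift_right : shift φ e g g = 0 := by simp [shift]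

lemma shift_left (h : e ≠ g) : shift φ e g e = φ g := by simp [shift, h]

lemma shift_of_ne (h1 : f ≠ e) (h2 : f ≠ g) : shift φ e g f = φ f := by simp [shift, h1, h2]

lemma FanStep.ne (h : G.FanStep k φ v A B f g) (he0 : φ e = 0) : g ≠ e := by
  rintro rfl
  exact ne_zero_of_mem_missing h.2.2 he0

lemma IsOptimal.shift (h : IsOptimal G J₀ k φ) (hA : IsFanDomain G J₀ v A) (he : e ∈ A)
    (he0 : φ e = 0) (hs : G.FanStep k φ v A B e g) : IsOptimal G J₀ k (shift φ e g) := by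
  have hge := hs.ne he0
  have hmiss := (mem_missing.1 hs.2.2)
  have hg0 := ne_zero_of_mem_missing hs.2.2
  have hlink := (hA.inc e he).isLink_farEnd
  -- at an end of `e`, the edge `g` is the only one that can have the color moved to `e`
  have key : ∀ f u, G.Inc e u → G.Inc f u → φ f = φ g → f = g := by
    intro f u hu hf hfg
    rcases hu.eq_or_eq_of_isLink hlink with rfl | rfl
    · exact h.proper hf (hA.inc g hs.1) hfg (hfg ▸ hg0)
    · exact absurd hfg (hmiss.2 f hf)
  have hU : G.uncolored (Graph.shift φ e g) = insert g (G.uncolored φ \ {e}) := by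
    ext f
    by_cases h1 : f = g
    · subst h1
      simp [uncolored, shift_right, (hA.inc f hs.1).edge_mem]
    by_cases h2 : f = e
    · subst h2
      simp [uncolored, shift_left h1, hg0, h1]
    · simp [uncolored, shift_of_ne h2 h1, h1, h2]
  refine ⟨⟨fun f hf => ?_, fun f f' u hf hf' hff hf0 => ?_, fun f hf => ?_, ?_⟩, ?_⟩
  · by_cases h1 : f = g
    · subst h1; simp [shift_right]
    by_cases h2 : f = e
    · subst h2; rw [shift_left h1]; exact hmiss.1.2
    · rw [shift_of_ne h2 h1]; exact h.le f hf
  · have h1 : f ≠ g := by rintro rfl; exact hf0 shift_right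
    have h1' : f' ≠ g := by rintro rfl; exact hf0 (hff.trans shift_right)
    by_cases h2 : f = e <;> by_cases h2' : f' = e
    · rw [h2, h2']
    · subst h2
      rw [shift_left h1, shift_of_ne h2' h1'] at hff
      exact absurd (key f' u hf hf' hff.symm) h1'
    · subst h2'
      rw [shift_left h1', shift_of_ne h2 h1] at hff
      exact absurd (key f u hf' hf hff) h1
    · rw [shift_of_ne h2 h1, shift_of_ne h2' h1'] at hff
      rw [shift_of_ne h2 h1] at hf0
      exact h.proper hf hf' hff hf0
  · rw [shift_of_ne (by rintro rfl; exact hA.notMem _ he hf)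
      (by rintro rfl; exact hA.notMem _ hs.1 hf)]
    exact h.colored f hf
  · intro f hf f' hf' hff
    rw [shift_of_ne (by rintro rfl; exact hA.notMem _ he hf)
      (by rintro rfl; exact hA.notMem _ hs.1 hf),
      shift_of_ne (by rintro rfl; exact hA.notMem _ he hf')
      (by rintro rfl; exact hA.notMem _ hs.1 hf')] at hff
    exact h.injOn hf hf' hff
  · intro ψ hψ
    rw [hU, Set.ncard_exchange (fun hg => hg0 hg.2) (show e ∈ G.uncolored φ from
      ⟨(hA.inc e he).edge_mem, he0⟩)]
    exact h.ncard_le ψ hψ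

lemma IsFanDomain.missing_subset_shift [G.Loopless] (hA : IsFanDomain G J₀ v A) (he : e ∈ A) (hf : f ∈ A)
    (hfe : f ≠ e) :
    G.missing k φ (G.farEnd v f) ⊆ G.missing k (Graph.shift φ e g) (G.farEnd v f) := by
  intro c hc
  have hc0 := ne_zero_of_mem_missing hc
  rw [mem_missing] at hc ⊢
  refine ⟨hc.1, fun f' hf' => ?_⟩
  by_cases h1 : f' = g
  · subst h1; rw [shift_right]; exact hc0.symm
  by_cases h2 : f' = e
  · subst h2
    rcases hf'.eq_or_eq_of_isLink (hA.inc f' he).isLink_farEnd with h3 | h3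
    · exact absurd h3.symm (hA.inc f hf).isLink_farEnd.ne
    · exact absurd (hA.injOn_farEnd hf he h3) hfe
  · rw [shift_of_ne h2 h1]
    exact hc.2 f' hf'

lemma IsFanDomain.missing_center_subset_shift (hA : IsFanDomain G J₀ v A) (hg : g ∈ A)
    (hge : g ≠ e) : G.missing k φ v ⊆ G.missing k (Graph.shift φ e g) v := by
  intro c hc
  have hc0 := ne_zero_of_mem_missing hc
  rw [mem_missing] at hc ⊢
  refine ⟨hc.1, fun f hf => ?_⟩
  by_cases h1 : f = g
  · subst h1; rw [shift_right]; exact hc0.symm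
  by_cases h2 : f = e
  · subst h2; rw [shift_left hge.symm]; exact hc.2 g (hA.inc g hg)
  · rw [shift_of_ne h2 h1]; exact hc.2 f hf

lemma FanReach.shift [G.Loopless] (h : G.FanReach k φ v A B g f) (hA : IsFanDomain G J₀ v A)
    (he : e ∈ A) (hg : g ∈ A) (he0 : φ e = 0) (hge : g ≠ e) (hB : φ g ∈ B) :
    G.FanReach k (Graph.shift φ e g) v A B g f ∧ f ≠ e := by
  induction h with
  | refl => exact ⟨.refl, hge⟩
  | @tail f f' hr hs ih =>
    have hf'e := hs.ne he0
    refine ⟨ih.1.tail ⟨hs.1, ?_, ?_⟩, hf'e⟩ <;>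
      rw [shift_of_ne hf'e (by rintro rfl; exact hs.2.1 hB)]
    · exact hs.2.1
    · exact hA.missing_subset_shift he (FanReach.mem hr hg) ih.2 hs.2.2

/-- If `f` lies in the fan that starts with the uncolored edge `e`, then the colors of the edges
between them can be moved along the fan so that `f` becomes the uncolored edge. The induction is on
the number of colors that are still allowed. -/
lemma IsOptimal.exists_shift [G.Loopless] (h : IsOptimal G J₀ k φ) (hA : IsFanDomain G J₀ v A)
    (he : e ∈ A) (he0 : φ e = 0) (hr : G.FanReach k φ v A B e f) :
    ∃ ψ, IsOptimal G J₀ k ψ ∧ ψ f = 0 ∧ (∀ j ∈ J₀, ψ j = φ j) ∧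
      G.missing k φ v ⊆ G.missing k ψ v ∧
      G.missing k φ (G.farEnd v f) ⊆ G.missing k ψ (G.farEnd v f) := by
  induction hn : (Set.Icc 1 k \ B).ncard using Nat.strong_induction_on generalizing φ e B with
  | _ n ih =>
  rcases Relation.ReflTransGen.cases_head hr with rfl | ⟨g, hs, hr'⟩
  · exact ⟨φ, h, he0, fun _ _ => rfl, subset_rfl, subset_rfl⟩
  have hge := hs.ne he0
  have hg0 := ne_zero_of_mem_missing hs.2.2
  have hr1 : G.FanReach k φ v A (insert (φ g) B) g f :=
    (FanReach.or_of_mem hr' h.toIsRainbowPartial hA hs.1 hg0).elim id id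
  obtain ⟨hr2, hfe⟩ := hr1.shift hA he hs.1 he0 hge (Set.mem_insert _ _)
  have hlt : (Set.Icc 1 k \ insert (φ g) B).ncard < n := by
    rw [← hn]
    refine Set.ncard_lt_ncard ⟨Set.sdiff_subset_sdiff_right (Set.subset_insert _ _), fun hsub => ?_⟩
      ((Set.finite_Icc 1 k).subset Set.sdiff_subset)
    exact (hsub ⟨(mem_missing.1 hs.2.2).1, hs.2.1⟩).2 (Set.mem_insert _ _)
  obtain ⟨ψ, h1, h2, h3, h4, h5⟩ := ih _ hlt (h.shift hA he he0 hs) hs.1 shift_right hr2 rfl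
  refine ⟨ψ, h1, h2, fun j hj => ?_, (hA.missing_center_subset_shift hs.1 hge).trans h4,
    (hA.missing_subset_shift he (hr1.mem hs.1) hfe).trans h5⟩
  rw [h3 j hj, shift_of_ne (by rintro rfl; exact hA.notMem _ he hj)
    (by rintro rfl; exact hA.notMem _ hs.1 hj)]

/-- In an optimal coloring, the center of a fan and the far end of a fan edge miss no common
color. -/
lemma IsOptimal.notMem_missing_farEnd [G.Loopless] (h : IsOptimal G J₀ k φ)
    (hE : G.edgeSet.Finite) (hA : IsFanDomain G J₀ v A) (he : e ∈ A) (he0 : φ e = 0)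
    (hr : G.FanReach k φ v A B e f) (hv : c ∈ G.missing k φ v) :
    c ∉ G.missing k φ (G.farEnd v f) := by
  obtain ⟨ψ, h1, h2, -, h4, h5⟩ := h.exists_shift hA he he0 hr
  exact fun hc => h1.disjoint_missing hE (hA.inc f (hr.mem he)).isLink_farEnd h2 (h4 hv) (h5 hc)

/-- A Kempe change that respects the rainbow set cannot separate the center of a fan from the far
end of a fan edge. -/
lemma IsOptimal.mem_iff_farEnd_mem [G.Loopless] (h : IsOptimal G J₀ k φ)
    (hE : G.edgeSet.Finite) (hA : IsFanDomain G J₀ v A) (he : e ∈ A) (he0 : φ e = 0)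
    (hS : KempeClosed G φ a b S) (ha : a ∈ G.missing k φ v)
    (hinj : Set.InjOn (G.kempeSwap φ a b S) J₀) (hr : G.FanReach k φ v A ∅ e f)
    (hb : b ∈ G.missing k φ (G.farEnd v f)) : v ∈ S ↔ G.farEnd v f ∈ S := by
  have ha1 := (mem_missing.1 ha).1
  have hb1 := (mem_missing.1 hb).1
  have hψ := h.kempeSwap hS ha1 hb1 hinj
  have he0' : G.kempeSwap φ a b S e = 0 :=
    (kempeSwap_eq_zero_iff (ne_zero_of_mem_missing ha) (ne_zero_of_mem_missing hb)).2 he0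
  have sep : ∀ g, G.FanReach k (G.kempeSwap φ a b S) v A ∅ e g →
      b ∈ G.missing k φ (G.farEnd v g) → (v ∈ S ↔ G.farEnd v g ∈ S) := by
    intro g hg hbg
    have hdis := fun c => hψ.notMem_missing_farEnd (c := c) hE hA he he0' hg
    constructor <;> intro hv <;> by_contra hw
    · refine hdis b ?_ ?_
      · rwa [mem_missing_kempeSwap hv ha1 hb1, Equiv.swap_apply_right]
      · rwa [hS.mem_missing_kempeSwap_of_notMem hw]
    · refine hdis a ?_ ?_
      · rwa [hS.mem_missing_kempeSwap_of_notMem hw]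
      · rwa [mem_missing_kempeSwap hv ha1 hb1, Equiv.swap_apply_left]
  refine sep f ?_ hb
  clear hb
  induction hr with
  | refl => exact .refl
  | @tail f f' hr' hs ih =>
    refine ih.tail ⟨hs.1, Set.notMem_empty _, ?_⟩
    have hf'v := hA.inc f' hs.1
    have hca : φ f' ≠ a := (mem_missing.1 ha).2 f' hf'v
    by_cases hcb : φ f' = b
    · have hiff := sep f ih (hcb ▸ hs.2.2)
      by_cases hv : v ∈ S
      · rw [kempeSwap_of_mem hf'v hv, hcb, Equiv.swap_apply_right,
          mem_missing_kempeSwap (hiff.1 hv) ha1 hb1, Equiv.swap_apply_left, ← hcb]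
        exact hs.2.2
      · rw [hS.kempeSwap_of_notMem hf'v hv,
          hS.mem_missing_kempeSwap_of_notMem (fun hw => hv (hiff.2 hw))]
        exact hs.2.2
    · rw [kempeSwap_of_ne hca hcb]
      by_cases hw : G.farEnd v f ∈ S
      · rw [mem_missing_kempeSwap hw ha1 hb1, Equiv.swap_apply_of_ne_of_ne hca hcb]
        exact hs.2.2
      · rw [hS.mem_missing_kempeSwap_of_notMem hw]
        exact hs.2.2

/-! ### Counting the missing colors in a fan -/

open Classical in
/-- The number of edges in the finite set `W` of edges at `v` whose far end misses the color `c`. -/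
noncomputable def missCount (G : Graph α β) (k : ℕ) (φ : β → ℕ) (v : α) (W : Finset β) (c : ℕ) : ℕ :=
  {f ∈ W | c ∈ G.missing k φ (G.farEnd v f)}.card

/-- Each color missing at the far end of a fan edge appears at the center, either on a
fan edge or on an edge outside the fan domain. -/
lemma IsOptimal.exists_of_mem_missing_farEnd [G.Loopless] (h : IsOptimal G J₀ k φ)
    (hE : G.edgeSet.Finite) (hA : IsFanDomain G J₀ v A) (he : e ∈ A) (he0 : φ e = 0)
    (hr : G.FanReach k φ v A ∅ e f) (hc : c ∈ G.missing k φ (G.farEnd v f)) :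
    ∃ g, G.Inc g v ∧ φ g = c ∧ g ≠ e ∧ (g ∈ A → G.FanReach k φ v A ∅ e g) := by
  have h1 : c ∉ G.missing k φ v :=
    fun hv => h.notMem_missing_farEnd hE hA he he0 hr hv hc
  rw [mem_missing] at h1
  push Not at h1
  obtain ⟨g, hg, rfl⟩ := h1 (mem_missing.1 hc).1
  refine ⟨g, hg, rfl, ?_, fun hgA => hr.tail ⟨hgA, Set.notMem_empty _, hc⟩⟩
  rintro rfl
  exact ne_zero_of_mem_missing hc he0

lemma sum_card_missing_le [DecidableEq β] {W D : Finset β}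
    (h : ∀ f ∈ W, ∀ c ∈ G.missing k φ (G.farEnd v f), ∃ g ∈ W.erase e ∪ D, φ g = c) :
    ∑ f ∈ W, (G.missing k φ (G.farEnd v f)).card ≤
      ∑ g ∈ W.erase e, G.missCount k φ v W (φ g) + ∑ g ∈ D, G.missCount k φ v W (φ g) := by
  classical
  calc ∑ f ∈ W, (G.missing k φ (G.farEnd v f)).card
      ≤ ∑ f ∈ W, ∑ g ∈ W.erase e ∪ D, if φ g ∈ G.missing k φ (G.farEnd v f) then 1 else 0 := by
        refine Finset.sum_le_sum fun f hf => ?_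
        rw [← Finset.card_filter]
        refine (Finset.card_le_card (t := Finset.image φ _) fun c hc => ?_).trans
          Finset.card_image_le
        obtain ⟨g, hg, rfl⟩ := h f hf c hc
        exact Finset.mem_image_of_mem _ (Finset.mem_filter.2 ⟨hg, hc⟩)
    _ = ∑ g ∈ W.erase e ∪ D, G.missCount k φ v W (φ g) := by
        rw [Finset.sum_comm]
        refine Finset.sum_congr rfl fun g _ => ?_
        rw [missCount, Finset.card_filter]
    _ ≤ _ := by
        rw [← Finset.sum_union_inter]
        exact Nat.le_add_right _ _

lemma kempeSwap_eq_or_eq (h : φ e = a ∨ φ e = b) :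
    G.kempeSwap φ a b S e = a ∨ G.kempeSwap φ a b S e = b := by
  unfold kempeSwap
  split_ifs
  · rcases h with h | h <;> simp [h]
  · exact h

lemma injOn_kempeSwap (h : IsRainbowPartial G J₀ k φ)
    (hab : ∀ i ∈ J₀, ∀ j ∈ J₀, φ i = a → φ j = b →
      G.kempeSwap φ a b S i ≠ G.kempeSwap φ a b S j) :
    Set.InjOn (G.kempeSwap φ a b S) J₀ := by
  intro i hi j hj hij
  by_cases h1 : φ i = a ∨ φ i = b <;> by_cases h2 : φ j = a ∨ φ j = b
  · rcases h1 with h1 | h1 <;> rcases h2 with h2 | h2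
    · exact h.injOn hi hj (h1.trans h2.symm)
    · exact absurd hij (hab i hi j hj h1 h2)
    · exact absurd hij.symm (hab j hj i hi h2 h1)
    · exact h.injOn hi hj (h1.trans h2.symm)
  · have h3 := kempeSwap_eq_or_eq (G := G) (S := S) h1
    rw [hij, kempeSwap_of_ne (fun h => h2 (.inl h)) (fun h => h2 (.inr h))] at h3
    exact absurd h3 h2
  · have h3 := kempeSwap_eq_or_eq (G := G) (S := S) h2
    rw [← hij, kempeSwap_of_ne (fun h => h1 (.inl h)) (fun h => h1 (.inr h))] at h3
    exact absurd h3 h1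
  · rw [kempeSwap_of_ne (fun h => h1 (.inl h)) (fun h => h1 (.inr h)),
      kempeSwap_of_ne (fun h => h2 (.inl h)) (fun h => h2 (.inr h))] at hij
    exact h.injOn hi hj hij

lemma exists_inc_of_not_injOn_kempeSwap (h : IsRainbowPartial G J₀ k φ)
    (hS : ¬ Set.InjOn (G.kempeSwap φ a b S) J₀) :
    ∃ i ∈ J₀, (φ i = a ∨ φ i = b) ∧ ∃ z ∈ S, G.Inc i z := by
  by_contra! hcon
  refine hS (h.injOn.congr fun i hi => ?_)
  by_cases hab : φ i = a ∨ φ i = b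
  · exact (kempeSwap_of_forall_notMem (hcon i hi hab)).symm
  · exact (kempeSwap_of_ne (fun h => hab (.inl h)) (fun h => hab (.inr h))).symm

lemma kempeComponent_eq_of_inc {i : β} {u' z z' : α} (hi : φ i = a ∨ φ i = b)
    (hz : z ∈ G.kempeComponent φ a b u) (hiz : G.Inc i z)
    (hz' : z' ∈ G.kempeComponent φ a b u') (hiz' : G.Inc i z') :
    G.kempeComponent φ a b u = G.kempeComponent φ a b u' := by
  have h : z' ∈ G.kempeComponent φ a b u := by
    obtain ⟨y, hy⟩ := hiz
    rcases hiz'.eq_or_eq_of_isLink hy with rfl | rfl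
    · exact hz
    · exact kempeClosed_kempeComponent φ a b u hy hi hz
  rw [← kempeComponent_eq_of_mem h, kempeComponent_eq_of_mem hz']

/-- If `a` is missing at the center of a fan and the Kempe change on the component of the center
respects the rainbow set, then `b` is missing at the far end of at most one fan edge. -/
lemma IsOptimal.eq_of_injOn_kempeSwap [G.Loopless] (h : IsOptimal G J₀ k φ)
    (hV : G.vertexSet.Finite) (hE : G.edgeSet.Finite) (hA : IsFanDomain G J₀ v A) (he : e ∈ A)
    (he0 : φ e = 0) (ha : a ∈ G.missing k φ v)
    (hinj : Set.InjOn (G.kempeSwap φ a b (G.kempeComponent φ a b v)) J₀)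
    (hf : G.FanReach k φ v A ∅ e f) (hbf : b ∈ G.missing k φ (G.farEnd v f))
    (hg : G.FanReach k φ v A ∅ e g) (hbg : b ∈ G.missing k φ (G.farEnd v g)) : f = g := by
  by_contra hne
  have hv : v ∈ G.vertexSet := (hA.inc e he).vertex_mem
  have hsep := fun f (hf : G.FanReach k φ v A ∅ e f) hb => (h.mem_iff_farEnd_mem hE hA he he0
    (kempeClosed_kempeComponent φ a b v) ha hinj hf hb).1 mem_kempeComponent_self
  have h1 := ncard_missing_kempeComponent_le hV h.toIsRainbowPartial hv
    (ne_zero_of_mem_missing ha) (ne_zero_of_mem_missing hbf)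
  have hfin : ∀ c, {z | z ∈ G.kempeComponent φ a b v ∧ c ∈ G.missing k φ z}.Finite :=
    fun c => hV.subset fun z hz => kempeComponent_subset hv hz.1
  have h2 : 0 < {z | z ∈ G.kempeComponent φ a b v ∧ a ∈ G.missing k φ z}.ncard :=
    (Set.ncard_pos (hfin a)).2 ⟨v, mem_kempeComponent_self, ha⟩
  have h3 : 1 < {z | z ∈ G.kempeComponent φ a b v ∧ b ∈ G.missing k φ z}.ncard :=
    (Set.one_lt_ncard (hfin b)).2 ⟨_, ⟨hsep f hf hbf, hbf⟩, _, ⟨hsep g hg hbg, hbg⟩,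
      fun hfg => hne (hA.injOn_farEnd (hf.mem he) (hg.mem he) hfg)⟩
  omega

lemma missCount_le_one {W : Finset β} (h : ∀ f ∈ W, ∀ g ∈ W, c ∈ G.missing k φ (G.farEnd v f) →
    c ∈ G.missing k φ (G.farEnd v g) → f = g) : G.missCount k φ v W c ≤ 1 := by
  classical
  refine Finset.card_le_one.2 fun f hf g hg => ?_
  rw [Finset.mem_filter] at hf hg
  exact h f hf.1 g hg.1 hf.2 hg.2

lemma finite_setOf_fanReach (hE : G.edgeSet.Finite) (hA : IsFanDomain G J₀ v A) (he : e ∈ A) :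
    {f | G.FanReach k φ v A ∅ e f}.Finite :=
  hE.subset fun f hf => (hA.inc f (FanReach.mem hf he)).edge_mem

lemma IsOptimal.sum_card_missing_fan_le [DecidableEq β] [G.Loopless] (h : IsOptimal G J₀ k φ)
    (hE : G.edgeSet.Finite) (hA : IsFanDomain G J₀ v A) (he : e ∈ A) (he0 : φ e = 0)
    {W D : Finset β} (hW : ∀ f, f ∈ W ↔ G.FanReach k φ v A ∅ e f)
    (hD : ∀ g, g ∈ D ↔ G.Inc g v ∧ g ∉ A) :
    ∑ f ∈ W, (G.missing k φ (G.farEnd v f)).card ≤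
      ∑ g ∈ W.erase e, G.missCount k φ v W (φ g) + ∑ g ∈ D, G.missCount k φ v W (φ g) := by
  refine sum_card_missing_le fun f hf c hc => ?_
  obtain ⟨g, h1, h2, h3, h4⟩ := h.exists_of_mem_missing_farEnd hE hA he he0 ((hW f).1 hf) hc
  refine ⟨g, ?_, h2⟩
  by_cases hgA : g ∈ A
  · exact Finset.mem_union_left _ (Finset.mem_erase.2 ⟨h3, (hW g).2 (h4 hgA)⟩)
  · exact Finset.mem_union_right _ ((hD g).2 ⟨h1, hgA⟩)

/-- If no color is missing at the far ends of two different fan edges, then the number of colors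
missing at the far ends of the fan edges is less than the number of edges that are in the fan or
outside the fan domain. -/
lemma IsOptimal.sum_card_missing_lt [G.Loopless] (h : IsOptimal G J₀ k φ)
    (hE : G.edgeSet.Finite) (hA : IsFanDomain G J₀ v A) (he : e ∈ A) (he0 : φ e = 0)
    {W : Finset β} (hW : ∀ f, f ∈ W ↔ G.FanReach k φ v A ∅ e f)
    (h1 : ∀ c, ∀ f ∈ W, ∀ g ∈ W, c ∈ G.missing k φ (G.farEnd v f) →
      c ∈ G.missing k φ (G.farEnd v g) → f = g) :
    ∑ f ∈ W, (G.missing k φ (G.farEnd v f)).card < W.card + ({f | G.Inc f v} \ A).ncard := by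
  classical
  have hDfin : ({f | G.Inc f v} \ A).Finite := hE.subset fun f hf => hf.1.edge_mem
  have h2 := h.sum_card_missing_fan_le hE hA he he0 (W := W) (D := hDfin.toFinset) hW (by simp)
  have h3 := Finset.sum_le_card_nsmul (W.erase e) (fun g => G.missCount k φ v W (φ g)) 1
    fun g _ => missCount_le_one (h1 _)
  have h4 := Finset.sum_le_card_nsmul hDfin.toFinset (fun g => G.missCount k φ v W (φ g)) 1
    fun g _ => missCount_le_one (h1 _)
  have heW : e ∈ W := (hW e).2 .refl
  have h5 := Finset.card_erase_of_mem heW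
  have h6 := Finset.card_pos.2 ⟨e, heW⟩
  rw [Set.ncard_eq_toFinset_card _ hDfin]
  simp only [smul_eq_mul, mul_one] at h3 h4
  omega

/-! ### Bipartite graphs with an apex -/

section Bipartite

variable {X Y : Set α}

lemma ncard_inter_sees_le (hV : G.vertexSet.Finite) (hφ : IsRainbowPartial G J₀ k φ)
    (hbip : ∀ e u w, G.IsLink e u w → u ≠ x → w ≠ x → u ∈ X → w ∈ Y) {T : Set α}
    (hT : KempeClosed G φ a b T) (hTV : T ⊆ G.vertexSet) (hx : x ∉ T) (hc : c = a ∨ c = b)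
    (hc0 : c ≠ 0) :
    {z | z ∈ T ∧ z ∈ X ∧ ∃ e, G.Inc e z ∧ φ e = c}.ncard ≤
      {z | z ∈ T ∧ z ∈ Y ∧ ∃ e, G.Inc e z ∧ φ e = c}.ncard := by
  classical
  have hpart : ∀ z, ∃ y, z ∈ {z | z ∈ T ∧ z ∈ X ∧ ∃ e, G.Inc e z ∧ φ e = c} →
      ∃ e, G.IsLink e z y ∧ φ e = c := by
    intro z
    by_cases hz : z ∈ {z | z ∈ T ∧ z ∈ X ∧ ∃ e, G.Inc e z ∧ φ e = c}
    · obtain ⟨-, -, e, ⟨y, hy⟩, hec⟩ := hz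
      exact ⟨y, fun _ => ⟨e, hy, hec⟩⟩
    · exact ⟨z, fun h => absurd h hz⟩
  choose p hp using hpart
  refine Set.ncard_le_ncard_of_injOn p (fun z hz => ?_) (fun z hz z' hz' hzz => ?_)
    (hV.subset fun z hz => hTV hz.1)
  · obtain ⟨e, he, hec⟩ := hp z hz
    have hpT : p z ∈ T := hT he (hec ▸ hc) hz.1
    exact ⟨hpT, hbip e z (p z) he (fun h => hx (h ▸ hz.1)) (fun h => hx (h ▸ hpT)) hz.2.1, e,
      he.inc_right, hec⟩
  · obtain ⟨e, he, hec⟩ := hp z hz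
    obtain ⟨e', he', hec'⟩ := hp z' hz'
    rw [← hzz] at he'
    obtain rfl := hφ.proper he.inc_right he'.inc_right (hec.trans hec'.symm) (hec ▸ hc0)
    exact he.left_unique he'

/-- In a Kempe component avoiding `x`, the edges of color `c` match the vertices of `X` that see
`c` with those of `Y` that do. -/
lemma ncard_inter_missing (hV : G.vertexSet.Finite) (hφ : IsRainbowPartial G J₀ k φ)
    (hXY : ∀ e u w, G.IsLink e u w → u ≠ x → w ≠ x → u ∈ X → w ∈ Y)
    (hYX : ∀ e u w, G.IsLink e u w → u ≠ x → w ≠ x → u ∈ Y → w ∈ X) {T : Set α}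
    (hT : KempeClosed G φ a b T) (hTV : T ⊆ G.vertexSet) (hx : x ∉ T) (hc : c = a ∨ c = b)
    (hck : c ∈ Set.Icc 1 k) :
    (T ∩ X).ncard + {z | z ∈ T ∧ z ∈ Y ∧ c ∈ G.missing k φ z}.ncard =
      (T ∩ Y).ncard + {z | z ∈ T ∧ z ∈ X ∧ c ∈ G.missing k φ z}.ncard := by
  have hc0 : c ≠ 0 := by have := hck.1; omega
  have h1 := ncard_inter_sees_le hV hφ hXY hT hTV hx hc hc0
  have h2 := ncard_inter_sees_le hV hφ hYX hT hTV hx hc hc0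
  have key : ∀ Z : Set α, (T ∩ Z).ncard =
      {z | z ∈ T ∧ z ∈ Z ∧ ∃ e, G.Inc e z ∧ φ e = c}.ncard +
        {z | z ∈ T ∧ z ∈ Z ∧ c ∈ G.missing k φ z}.ncard := by
    intro Z
    rw [← Set.ncard_union_eq _ (hV.subset fun z hz => hTV hz.1) (hV.subset fun z hz => hTV hz.1)]
    · congr 1
      ext z
      simp only [Set.mem_inter_iff, Set.mem_union, Set.mem_ofPred_eq, mem_missing, hck, true_and]
      constructor
      · rintro ⟨hz, hzZ⟩
        by_cases hs : ∃ e, G.Inc e z ∧ φ e = c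
        · exact .inl ⟨hz, hzZ, hs⟩
        · exact .inr ⟨hz, hzZ, by simpa using hs⟩
      · rintro (h | h) <;> exact ⟨h.1, h.2.1⟩
    · rw [Set.disjoint_left]
      rintro z ⟨-, -, e, he, hec⟩ ⟨-, -, hm⟩
      exact (mem_missing.1 hm).2 e he hec
  have h3 := key X
  have h4 := key Y
  omega

/-- If the apex `x` misses one of the colors `a` and `b`, then a component of these two colors
has at most one end that is either in `Y` and misses `a`, or in `X` and misses `b`. -/
lemma ncard_ends_le_one (hV : G.vertexSet.Finite) (hφ : IsRainbowPartial G J₀ k φ)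
    (hXY : ∀ e u w, G.IsLink e u w → u ≠ x → w ≠ x → u ∈ X → w ∈ Y)
    (hYX : ∀ e u w, G.IsLink e u w → u ≠ x → w ≠ x → u ∈ Y → w ∈ X)
    (hdisj : Disjoint X Y) (hxX : x ∉ X) (hxY : x ∉ Y) (hu : u ∈ G.vertexSet)
    (ha : a ∈ Set.Icc 1 k) (hb : b ∈ Set.Icc 1 k)
    (hx : a ∈ G.missing k φ x ∨ b ∈ G.missing k φ x) :
    {z | z ∈ G.kempeComponent φ a b u ∧ z ∈ Y ∧ a ∈ G.missing k φ z}.ncard +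
      {z | z ∈ G.kempeComponent φ a b u ∧ z ∈ X ∧ b ∈ G.missing k φ z}.ncard ≤ 1 := by
  set T := G.kempeComponent φ a b u with hT
  have hTV : T ⊆ G.vertexSet := kempeComponent_subset hu
  have ha0 : a ≠ 0 := by have := ha.1; omega
  have hb0 : b ≠ 0 := by have := hb.1; omega
  have htot := ncard_missing_kempeComponent_le hV hφ hu ha0 hb0
  rw [← hT] at htot
  have hfin : ∀ P : α → Prop, {z | z ∈ T ∧ P z}.Finite := fun P => hV.subset fun z hz => hTV hz.1
  have hsplit : ∀ c, {z | z ∈ T ∧ z ∈ X ∧ c ∈ G.missing k φ z}.ncard +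
      {z | z ∈ T ∧ z ∈ Y ∧ c ∈ G.missing k φ z}.ncard +
      {z | z ∈ T ∧ z = x ∧ c ∈ G.missing k φ z}.ncard ≤
        {z | z ∈ T ∧ c ∈ G.missing k φ z}.ncard := by
    intro c
    rw [← Set.ncard_union_eq _ (hfin _) (hfin _), ← Set.ncard_union_eq _ _ (hfin _)]
    · refine Set.ncard_le_ncard ?_ (hfin _)
      rintro z ((hz | hz) | hz) <;> exact ⟨hz.1, hz.2.2⟩
    · rw [Set.disjoint_left]
      rintro z (hz | hz) ⟨-, rfl, -⟩
      · exact hxX hz.2.1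
      · exact hxY hz.2.1
    · exact (hfin _).union (hfin _)
    · rw [Set.disjoint_left]
      rintro z hz hz'
      exact Set.disjoint_left.1 hdisj hz.2.1 hz'.2.1
  have h1 := hsplit a
  have h2 := hsplit b
  by_cases hxT : x ∈ T
  · have h3 : ∀ c, c ∈ G.missing k φ x →
        0 < {z | z ∈ T ∧ z = x ∧ c ∈ G.missing k φ z}.ncard := fun c hc =>
      (Set.ncard_pos (hfin _)).2 ⟨x, hxT, rfl, hc⟩
    rcases hx with hx | hx
    · have := h3 a hx; omega
    · have := h3 b hx; omega
  · have hTc : KempeClosed G φ a b T := kempeClosed_kempeComponent φ a b u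
    have h3 := ncard_inter_missing hV hφ hXY hYX hTc hTV hxT (.inl rfl) ha
    have h4 := ncard_inter_missing hV hφ hXY hYX hTc hTV hxT (.inr rfl) hb
    omega

lemma mem_missing_or_of_not_injOn_kempeSwap (h : IsRainbowPartial G J₀ k φ)
    (hS : KempeClosed G φ a b S) (hinj : ¬ Set.InjOn (G.kempeSwap φ a b S) J₀)
    (hxJ : ∀ e, G.Inc e x → e ∈ J₀) (ha : a ∈ Set.Icc 1 k) (hb : b ∈ Set.Icc 1 k) (hab : a ≠ b) :
    a ∈ G.missing k φ x ∨ b ∈ G.missing k φ x := by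
  by_contra hcon
  simp only [mem_missing, not_or, not_and, not_forall, not_not, exists_prop] at hcon
  obtain ⟨i, hi, hia⟩ := hcon.1 ha
  obtain ⟨j, hj, hjb⟩ := hcon.2 hb
  refine hinj (injOn_kempeSwap h fun i' hi' j' hj' hia' hjb' => ?_)
  obtain rfl := h.injOn hi' (hxJ i hi) (hia'.trans hia.symm)
  obtain rfl := h.injOn hj' (hxJ j hj) (hjb'.trans hjb.symm)
  by_cases hx : x ∈ S
  · rw [kempeSwap_of_mem hi hx, kempeSwap_of_mem hj hx]
    exact fun h => hab (hia.symm.trans ((Equiv.injective _ h).trans hjb))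
  · rw [hS.kempeSwap_of_notMem hi hx, hS.kempeSwap_of_notMem hj hx, hia, hjb]
    exact hab

/-- In the bipartite case, no color is missing at the far ends of two different fan edges. -/
lemma IsOptimal.eq_of_bipartite [G.Loopless] (h : IsOptimal G J₀ k φ)
    (hV : G.vertexSet.Finite) (hE : G.edgeSet.Finite) (hA : IsFanDomain G J₀ v A) (he : e ∈ A)
    (he0 : φ e = 0)
    (hXY : ∀ e u w, G.IsLink e u w → u ≠ x → w ≠ x → u ∈ X → w ∈ Y)
    (hYX : ∀ e u w, G.IsLink e u w → u ≠ x → w ≠ x → u ∈ Y → w ∈ X)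
    (hdisj : Disjoint X Y) (hxX : x ∉ X) (hxY : x ∉ Y) (hxJ : ∀ e, G.Inc e x → e ∈ J₀)
    (hvY : v ∈ Y) (ha : a ∈ G.missing k φ v)
    (hf : G.FanReach k φ v A ∅ e f) (hbf : b ∈ G.missing k φ (G.farEnd v f))
    (hg : G.FanReach k φ v A ∅ e g) (hbg : b ∈ G.missing k φ (G.farEnd v g)) : f = g := by
  by_contra hne
  have hR := h.toIsRainbowPartial
  have ha1 := (mem_missing.1 ha).1
  have hb1 := (mem_missing.1 hbf).1
  have hab : a ≠ b := by
    rintro rfl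
    exact h.notMem_missing_farEnd hE hA he he0 hf ha hbf
  have hX : ∀ f, G.FanReach k φ v A ∅ e f → G.farEnd v f ∈ X := by
    intro f hf
    have hfA := hf.mem he
    have hl := (hA.inc f hfA).isLink_farEnd
    refine hYX f v _ hl (fun h => hxY (h ▸ hvY)) (fun h => hA.notMem f hfA (hxJ f ?_)) hvY
    exact h ▸ hl.inc_right
  set w₁ := G.farEnd v f with hw₁
  set w₂ := G.farEnd v g with hw₂
  have hw : w₁ ≠ w₂ := fun h => hne (hA.injOn_farEnd (hf.mem he) (hg.mem he) h)
  have hv : v ∈ G.vertexSet := (hA.inc e he).vertex_mem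
  have hw₁V : w₁ ∈ G.vertexSet := (hA.inc f (hf.mem he)).isLink_farEnd.right_mem
  have hw₂V : w₂ ∈ G.vertexSet := (hA.inc g (hg.mem he)).isLink_farEnd.right_mem
  have hclosed := kempeClosed_kempeComponent (G := G) φ a b
  have hbad : ¬ Set.InjOn (G.kempeSwap φ a b (G.kempeComponent φ a b v)) J₀ := fun hinj =>
    hne (h.eq_of_injOn_kempeSwap hV hE hA he he0 ha hinj hf hbf hg hbg)
  have hx := mem_missing_or_of_not_injOn_kempeSwap hR (hclosed v) hbad hxJ ha1 hb1 hab
  have hle := fun u hu => ncard_ends_le_one (u := u) hV hR hXY hYX hdisj hxX hxY hu ha1 hb1 hx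
  have hfin : ∀ u, u ∈ G.vertexSet → ∀ P : α → Prop,
      {z | z ∈ G.kempeComponent φ a b u ∧ P z}.Finite :=
    fun u hu P => hV.subset fun z hz => kempeComponent_subset hu hz.1
  -- the center and the two far ends lie in three different components
  have hd : ∀ w, w ∈ X → b ∈ G.missing k φ w → w ∉ G.kempeComponent φ a b v := by
    intro w hwX hbw hwv
    have h1 := hle v hv
    have h2 := (Set.ncard_pos (hfin v hv _)).2
      (⟨v, mem_kempeComponent_self, hvY, ha⟩ : {z | z ∈ G.kempeComponent φ a b v ∧ z ∈ Y ∧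
        a ∈ G.missing k φ z}.Nonempty)
    have h3 := (Set.ncard_pos (hfin v hv _)).2
      (⟨w, hwv, hwX, hbw⟩ : {z | z ∈ G.kempeComponent φ a b v ∧ z ∈ X ∧
        b ∈ G.missing k φ z}.Nonempty)
    omega
  have hd₁ := hd w₁ (hX f hf) hbf
  have hd₂ := hd w₂ (hX g hg) hbg
  have hd₁₂ : w₂ ∉ G.kempeComponent φ a b w₁ := by
    intro hmem
    have h1 := hle w₁ hw₁V
    have h2 : 1 < {z | z ∈ G.kempeComponent φ a b w₁ ∧ z ∈ X ∧ b ∈ G.missing k φ z}.ncard :=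
      (Set.one_lt_ncard (hfin w₁ hw₁V _)).2
      ⟨w₁, ⟨mem_kempeComponent_self, hX f hf, hbf⟩, w₂, ⟨hmem, hX g hg, hbg⟩, hw⟩
    omega
  have hun : ∀ f', G.FanReach k φ v A ∅ e f' → b ∈ G.missing k φ (G.farEnd v f') →
      ¬ Set.InjOn (G.kempeSwap φ a b (G.kempeComponent φ a b (G.farEnd v f'))) J₀ := by
    intro f' hf' hb' hinj
    have hv' := (h.mem_iff_farEnd_mem hE hA he he0 (hclosed _) ha hinj hf' hb').2
      mem_kempeComponent_self
    refine hd _ (hX f' hf') hb' ?_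
    rw [kempeComponent_eq_of_mem hv']
    exact mem_kempeComponent_self
  -- each of these components meets the edge of `J₀` of color `a` or that of color `b`
  obtain ⟨i, hi, hic, z, hz, hiz⟩ := exists_inc_of_not_injOn_kempeSwap hR hbad
  obtain ⟨i₁, hi₁, hic₁, z₁, hz₁, hiz₁⟩ := exists_inc_of_not_injOn_kempeSwap hR (hun f hf hbf)
  obtain ⟨i₂, hi₂, hic₂, z₂, hz₂, hiz₂⟩ := exists_inc_of_not_injOn_kempeSwap hR (hun g hg hbg)
  have h01 : i ≠ i₁ := by
    rintro rfl
    exact hd₁ (kempeComponent_eq_of_inc hic hz hiz hz₁ hiz₁ ▸ mem_kempeComponent_self)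
  have h02 : i ≠ i₂ := by
    rintro rfl
    exact hd₂ (kempeComponent_eq_of_inc hic hz hiz hz₂ hiz₂ ▸ mem_kempeComponent_self)
  have h12 : i₁ ≠ i₂ := by
    rintro rfl
    exact hd₁₂ (kempeComponent_eq_of_inc hic₁ hz₁ hiz₁ hz₂ hiz₂ ▸ mem_kempeComponent_self)
  have h01' : φ i ≠ φ i₁ := fun h => h01 (hR.injOn hi hi₁ h)
  have h02' : φ i ≠ φ i₂ := fun h => h02 (hR.injOn hi hi₂ h)
  have h12' : φ i₁ ≠ φ i₂ := fun h => h12 (hR.injOn hi₁ hi₂ h)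
  omega

/-- In the bipartite case, an optimal coloring leaves no edge uncolored. -/
lemma IsOptimal.false_of_bipartite [G.Loopless] (h : IsOptimal G J₀ k φ)
    (hV : G.vertexSet.Finite) (hE : G.edgeSet.Finite) (hA : IsFanDomain G J₀ v A) (he : e ∈ A)
    (he0 : φ e = 0)
    (hXY : ∀ e u w, G.IsLink e u w → u ≠ x → w ≠ x → u ∈ X → w ∈ Y)
    (hYX : ∀ e u w, G.IsLink e u w → u ≠ x → w ≠ x → u ∈ Y → w ∈ X)
    (hdisj : Disjoint X Y) (hxX : x ∉ X) (hxY : x ∉ Y) (hxJ : ∀ e, G.Inc e x → e ∈ J₀)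
    (hvY : v ∈ Y) (hcard : ({f | G.Inc f v} \ A).ncard ≤ 1)
    (hdegv : G.degree v ≤ k) (hdeg : ∀ u ∈ X, G.degree u < k) : False := by
  classical
  have h1 := lt_card_missing_add_degree (k := k) hE (hA.inc e he) he0
  obtain ⟨a, ha⟩ : (G.missing k φ v).Nonempty := Finset.card_pos.1 (by omega)
  have hfin := finite_setOf_fanReach (k := k) (φ := φ) hE hA he
  have hW : ∀ f, f ∈ hfin.toFinset ↔ G.FanReach k φ v A ∅ e f := by simp
  have h2 := h.sum_card_missing_lt hE hA he he0 hW fun c f hf g hg hcf hcg =>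
    h.eq_of_bipartite hV hE hA he he0 hXY hYX hdisj hxX hxY hxJ hvY ha ((hW f).1 hf) hcf
      ((hW g).1 hg) hcg
  have hX : ∀ f ∈ hfin.toFinset, G.farEnd v f ∈ X := by
    intro f hf
    have hfA := ((hW f).1 hf).mem he
    have hl := (hA.inc f hfA).isLink_farEnd
    refine hYX f v _ hl (fun h => hxY (h ▸ hvY)) (fun h => hA.notMem f hfA (hxJ f ?_)) hvY
    exact h ▸ hl.inc_right
  have heW := (hW e).2 .refl
  have h3 : hfin.toFinset.card + 1 ≤
      ∑ f ∈ hfin.toFinset, (G.missing k φ (G.farEnd v f)).card := by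
    rw [← Finset.add_sum_erase _ _ heW, ← Finset.card_erase_add_one heW]
    have h4 := lt_card_missing_add_degree (k := k) hE (hA.inc e he).isLink_farEnd.inc_right he0
    have h5 := hdeg _ (hX e heW)
    have h6 := Finset.card_nsmul_le_sum (hfin.toFinset.erase e)
      (fun f => (G.missing k φ (G.farEnd v f)).card) 1 fun f hf => by
        have h7 := hdeg _ (hX f (Finset.mem_of_mem_erase hf))
        have h8 := le_card_missing_add_degree (k := k) hE φ (G.farEnd v f)
        omega
    simp only [smul_eq_mul, mul_one] at h6
    omega
  omega

end Bipartite

/-! ### Colors that do not appear on the rainbow set -/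

lemma injOn_kempeSwap_of_free (h : IsRainbowPartial G J₀ k φ) (ha : ∀ j ∈ J₀, φ j ≠ a) :
    Set.InjOn (G.kempeSwap φ a b S) J₀ :=
  injOn_kempeSwap h fun i hi _ _ hia _ => absurd hia (ha i hi)

/-- In an optimal coloring, an end of an uncolored edge misses no color that is absent
from `J₀`. -/
lemma IsOptimal.notMem_missing_of_free [G.Loopless] (h : IsOptimal G J₀ k φ)
    (hV : G.vertexSet.Finite) (hE : G.edgeSet.Finite) (hdeg : ∀ v, G.degree v + 4 ≤ k)
    (hA : IsFanDomain G J₀ v A) (he : e ∈ A) (he0 : φ e = 0)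
    (hcard : ({f | G.Inc f v} \ A).ncard ≤ 3) (hd : ∀ j ∈ J₀, φ j ≠ d) :
    d ∉ G.missing k φ v := by
  intro hdv
  have hfin := finite_setOf_fanReach (k := k) (φ := φ) hE hA he
  have hW : ∀ f, f ∈ hfin.toFinset ↔ G.FanReach k φ v A ∅ e f := by simp
  have h1 := h.sum_card_missing_lt hE hA he he0 hW fun c f hf g hg hcf hcg =>
    h.eq_of_injOn_kempeSwap hV hE hA he he0 hdv (injOn_kempeSwap_of_free h.toIsRainbowPartial hd)
      ((hW f).1 hf) hcf ((hW g).1 hg) hcg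
  have h2 := Finset.card_nsmul_le_sum hfin.toFinset
    (fun f => (G.missing k φ (G.farEnd v f)).card) 4 fun f _ => by
      have h3 := le_card_missing_add_degree (k := k) hE φ (G.farEnd v f)
      have h4 := hdeg (G.farEnd v f)
      omega
  have h5 := Finset.card_pos.2 ⟨e, (hW e).2 .refl⟩
  simp only [smul_eq_mul] at h2
  omega

/-- The hypothesis that every edge outside `J₀` lies, at each of its ends, in a fan domain that
contains all but at most three edges at that end. -/
def HasFanDomains (G : Graph α β) (J₀ : Set β) : Prop :=
  ∀ v e, G.Inc e v → e ∉ J₀ →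
    ∃ A, IsFanDomain G J₀ v A ∧ e ∈ A ∧ ({f | G.Inc f v} \ A).ncard ≤ 3

lemma IsOptimal.notMem_missing_farEnd_of_free [G.Loopless] (h : IsOptimal G J₀ k φ)
    (hV : G.vertexSet.Finite) (hE : G.edgeSet.Finite) (hdeg : ∀ v, G.degree v + 4 ≤ k)
    (hdom : HasFanDomains G J₀) (hA : IsFanDomain G J₀ v A) (he : e ∈ A) (he0 : φ e = 0)
    (hd : ∀ j ∈ J₀, φ j ≠ d) (hr : G.FanReach k φ v A B e f) :
    d ∉ G.missing k φ (G.farEnd v f) := by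
  intro hdf
  obtain ⟨ψ, h1, h2, h3, -, h5⟩ := h.exists_shift hA he he0 hr
  have hfA := hr.mem he
  obtain ⟨A', hA', hfA', hcard⟩ :=
    hdom _ f (hA.inc f hfA).isLink_farEnd.inc_right (hA.notMem f hfA)
  exact h1.notMem_missing_of_free hV hE hdeg hA' hfA' h2 hcard
    (fun j hj => (h3 j hj).symm ▸ hd j hj) (h5 hdf)

/-- Let `d` be a color absent from `J₀`. A Kempe change of `b` and `d` on a set that avoids the edge
of `J₀` of color `b` leaves `d` absent from `J₀`, and it preserves the fan unless it recolors
the fan edge of color `b`. As no far end of a fan edge may miss `d` afterwards, none of them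
can lie in the set and miss `b`. -/
lemma IsOptimal.farEnd_notMem_of_free [G.Loopless] (h : IsOptimal G J₀ k φ)
    (hV : G.vertexSet.Finite) (hE : G.edgeSet.Finite) (hdeg : ∀ v, G.degree v + 4 ≤ k)
    (hdom : HasFanDomains G J₀) (hA : IsFanDomain G J₀ v A) (he : e ∈ A) (he0 : φ e = 0)
    (hd : ∀ j ∈ J₀, φ j ≠ d) (hdk : d ∈ Set.Icc 1 k) (hS : KempeClosed G φ b d S)
    (hSj : ∀ j ∈ J₀, φ j = b → ∀ u ∈ S, ¬ G.Inc j u) (hBv : b ∈ B ∨ v ∉ S)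
    (hr : G.FanReach k φ v A B e f) (hb : b ∈ G.missing k φ (G.farEnd v f)) :
    G.farEnd v f ∉ S := by
  have hbk := (mem_missing.1 hb).1
  have hJ : ∀ j ∈ J₀, G.kempeSwap φ b d S j = φ j := by
    intro j hj
    by_cases hjb : φ j = b
    · exact kempeSwap_of_forall_notMem (hSj j hj hjb)
    · exact kempeSwap_of_ne hjb (hd j hj)
  have hψ := h.kempeSwap hS hbk hdk (h.injOn.congr fun j hj => (hJ j hj).symm)
  have he0' : G.kempeSwap φ b d S e = 0 :=
    (kempeSwap_eq_zero_iff (ne_zero_of_mem_missing hb) (by have := hdk.1; omega)).2 he0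
  have key : ∀ g, G.FanReach k (G.kempeSwap φ b d S) v A B e g →
      b ∈ G.missing k φ (G.farEnd v g) → G.farEnd v g ∉ S := by
    intro g hg hbg hmem
    refine hψ.notMem_missing_farEnd_of_free hV hE hdeg hdom hA he he0'
      (fun j hj => (hJ j hj).symm ▸ hd j hj) hg ?_
    rwa [mem_missing_kempeSwap hmem hbk hdk, Equiv.swap_apply_right]
  refine key f ?_ hb
  clear hb
  induction hr with
  | refl => exact .refl
  | @tail f f' hr' hs ih =>
    have hf'v := hA.inc f' hs.1
    have hne_d : φ f' ≠ d := fun hfd =>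
      h.notMem_missing_farEnd_of_free hV hE hdeg hdom hA he he0 hd hr' (hfd ▸ hs.2.2)
    have hcol : G.kempeSwap φ b d S f' = φ f' := by
      by_cases hfb : φ f' = b
      · exact hS.kempeSwap_of_notMem hf'v (hBv.resolve_left (hfb ▸ hs.2.1))
      · exact kempeSwap_of_ne hfb hne_d
    refine ih.tail ⟨hs.1, hcol.symm ▸ hs.2.1, ?_⟩
    rw [hcol]
    by_cases hfb : φ f' = b
    · rw [hS.mem_missing_kempeSwap_of_notMem (key f ih (hfb ▸ hs.2.2))]
      exact hs.2.2
    · by_cases hw : G.farEnd v f ∈ S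
      · rw [mem_missing_kempeSwap hw hbk hdk, Equiv.swap_apply_of_ne_of_ne hfb hne_d]
        exact hs.2.2
      · rw [hS.mem_missing_kempeSwap_of_notMem hw]
        exact hs.2.2

lemma missCount_le_two (hV : G.vertexSet.Finite) (h : IsRainbowPartial G J₀ k φ)
    (hA : IsFanDomain G J₀ v A) {W : Finset β} (hWA : ↑W ⊆ A) (hu : u ∈ G.vertexSet) (hd : d ≠ 0)
    (hW : ∀ f ∈ W, b ∈ G.missing k φ (G.farEnd v f) →
      G.farEnd v f ∈ G.kempeComponent φ b d u) : G.missCount k φ v W b ≤ 2 := by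
  classical
  by_cases hb : b = 0
  · subst hb
    rw [missCount, Finset.filter_eq_empty_iff.2 fun f _ h => ne_zero_of_mem_missing h rfl]
    simp
  have h1 := ncard_missing_kempeComponent_le hV h hu hb hd
  have h2 : G.missCount k φ v W b ≤
      {z | z ∈ G.kempeComponent φ b d u ∧ b ∈ G.missing k φ z}.ncard := by
    rw [missCount, ← Set.ncard_coe_finset]
    refine Set.ncard_le_ncard_of_injOn (G.farEnd v) (fun f hf => ?_) (fun f hf g hg => ?_)
      (hV.subset fun z hz => kempeComponent_subset hu hz.1)
    · simp only [Finset.coe_filter, Set.mem_ofPred_eq] at hf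
      exact ⟨hW f hf.1 hf.2, hf.2⟩
    · simp only [Finset.coe_filter, Set.mem_ofPred_eq] at hf hg
      exact hA.injOn_farEnd (hWA hf.1) (hWA hg.1)
  omega

/-- A color is missing at the far ends of at most two fan edges that are reached without
using this color: they all lie in the Kempe component of the edge of `J₀` that has this color. -/
lemma IsOptimal.missCount_le_two_of_avoid [G.Loopless] (h : IsOptimal G J₀ k φ)
    (hV : G.vertexSet.Finite) (hE : G.edgeSet.Finite) (hdeg : ∀ v, G.degree v + 4 ≤ k)
    (hdom : HasFanDomains G J₀) (hJE : J₀ ⊆ G.edgeSet) (hA : IsFanDomain G J₀ v A) (he : e ∈ A)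
    (he0 : φ e = 0) (hd : ∀ j ∈ J₀, φ j ≠ d) (hdk : d ∈ Set.Icc 1 k) {W : Finset β}
    (hW : ∀ f ∈ W, G.FanReach k φ v A {b} e f) : G.missCount k φ v W b ≤ 2 := by
  by_cases hb : ∀ j ∈ J₀, φ j ≠ b
  · refine (missCount_le_one fun f hf _ _ hbf => ?_).trans one_le_two
    exact absurd hbf (h.notMem_missing_farEnd_of_free hV hE hdeg hdom hA he he0 hb (hW f hf))
  push Not at hb
  obtain ⟨j, hj, hjb⟩ := hb
  obtain ⟨z, y, hz⟩ := exists_isLink_of_mem_edgeSet (hJE hj)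
  have hd0 : d ≠ 0 := by have := hdk.1; omega
  refine missCount_le_two hV h.toIsRainbowPartial hA (fun f hf => (hW f hf).mem he) hz.left_mem
    hd0 fun f hf hbf => ?_
  by_contra hmem
  refine h.farEnd_notMem_of_free hV hE hdeg hdom hA he he0 hd hdk
    (kempeClosed_kempeComponent φ b d (G.farEnd v f)) (fun i hi hib u hu hiu => hmem ?_)
    (.inl (Set.mem_singleton b)) (hW f hf) hbf mem_kempeComponent_self
  obtain rfl := h.injOn hi hj (hib.trans hjb.symm)
  rw [kempeComponent_eq_of_inc (.inl hib) mem_kempeComponent_self hz.inc_left hu hiu]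
  exact mem_kempeComponent_self

/-- A color is missing at the far ends of at most four fan edges: these lie in the Kempe
component of the edge of `J₀` of this color or in that of the center. -/
lemma IsOptimal.missCount_le_four [G.Loopless] (h : IsOptimal G J₀ k φ)
    (hV : G.vertexSet.Finite) (hE : G.edgeSet.Finite) (hdeg : ∀ v, G.degree v + 4 ≤ k)
    (hdom : HasFanDomains G J₀) (hJE : J₀ ⊆ G.edgeSet) (hA : IsFanDomain G J₀ v A) (he : e ∈ A)
    (he0 : φ e = 0) (hd : ∀ j ∈ J₀, φ j ≠ d) (hdk : d ∈ Set.Icc 1 k) {W : Finset β}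
    (hW : ∀ f ∈ W, G.FanReach k φ v A ∅ e f) : G.missCount k φ v W b ≤ 4 := by
  classical
  have hd0 : d ≠ 0 := by have := hdk.1; omega
  have hv : v ∈ G.vertexSet := (hA.inc e he).vertex_mem
  set C := G.kempeComponent φ b d v with hC
  have hsplit : G.missCount k φ v W b ≤ G.missCount k φ v {f ∈ W | G.farEnd v f ∈ C} b +
      G.missCount k φ v {f ∈ W | G.farEnd v f ∉ C} b := by
    simp only [missCount]
    rw [← Finset.card_filter_add_card_filter_not (s := {f ∈ W | b ∈ G.missing k φ (G.farEnd v f)})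
      (fun f => G.farEnd v f ∈ C)]
    simp only [Finset.filter_filter, and_comm, le_refl]
  have h1 : G.missCount k φ v {f ∈ W | G.farEnd v f ∈ C} b ≤ 2 :=
    missCount_le_two hV h.toIsRainbowPartial hA
      (fun f hf => (hW f (Finset.mem_filter.1 hf).1).mem he) hv hd0
      fun f hf _ => (Finset.mem_filter.1 hf).2
  have h2 : G.missCount k φ v {f ∈ W | G.farEnd v f ∉ C} b ≤ 2 := by
    by_cases hb : ∀ j ∈ J₀, φ j ≠ b
    · refine (missCount_le_one fun f hf _ _ hbf => ?_).trans one_le_two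
      exact absurd hbf (h.notMem_missing_farEnd_of_free hV hE hdeg hdom hA he he0 hb
        (hW f (Finset.mem_filter.1 hf).1))
    push Not at hb
    obtain ⟨j, hj, hjb⟩ := hb
    obtain ⟨z, y, hz⟩ := exists_isLink_of_mem_edgeSet (hJE hj)
    refine missCount_le_two hV h.toIsRainbowPartial hA
      (fun f hf => (hW f (Finset.mem_filter.1 hf).1).mem he) hz.left_mem hd0 fun f hf hbf => ?_
    obtain ⟨hfW, hfC⟩ := Finset.mem_filter.1 hf
    by_contra hmem
    refine h.farEnd_notMem_of_free hV hE hdeg hdom hA he he0 hd hdk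
      (kempeClosed_kempeComponent φ b d (G.farEnd v f)) (fun i hi hib u hu hiu => hmem ?_)
      (.inr fun hvf => hfC ?_) (hW f hfW) hbf mem_kempeComponent_self
    · obtain rfl := h.injOn hi hj (hib.trans hjb.symm)
      rw [kempeComponent_eq_of_inc (.inl hib) mem_kempeComponent_self hz.inc_left hu hiu]
      exact mem_kempeComponent_self
    · rw [hC, kempeComponent_eq_of_mem hvf]
      exact mem_kempeComponent_self
  omega

/-- A color that is missing at the far end of the uncolored edge is missing at the far ends of at
most three fan edges. The fan edges reached without this color contribute at most two. The others
are reached from the fan edge `g` that has this color; after its color is moved to the uncolored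
edge, they are reached without this color, and the far end of `g` misses it too. -/
lemma IsOptimal.missCount_le_three [G.Loopless] (h : IsOptimal G J₀ k φ)
    (hV : G.vertexSet.Finite) (hE : G.edgeSet.Finite) (hdeg : ∀ v, G.degree v + 4 ≤ k)
    (hdom : HasFanDomains G J₀) (hJE : J₀ ⊆ G.edgeSet) (hA : IsFanDomain G J₀ v A) (he : e ∈ A)
    (he0 : φ e = 0) (hd : ∀ j ∈ J₀, φ j ≠ d) (hdk : d ∈ Set.Icc 1 k) {W : Finset β}
    (hW : ∀ f ∈ W, G.FanReach k φ v A ∅ e f) (hs : G.FanStep k φ v A ∅ e g) :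
    G.missCount k φ v W (φ g) ≤ 3 := by
  classical
  have hR := h.toIsRainbowPartial
  have hg0 := ne_zero_of_mem_missing hs.2.2
  have hge := hs.ne he0
  have hgv := hA.inc g hs.1
  set N : Finset β := {f ∈ W | G.FanReach k φ v A {φ g} e f} with hN
  set P : Finset β := {f ∈ W | G.FanReach k φ v A {φ g} g f ∧
    φ g ∈ G.missing k φ (G.farEnd v f)} with hP
  have hsub : G.missCount k φ v W (φ g) ≤ G.missCount k φ v N (φ g) + P.card := by
    refine (Finset.card_le_card fun f hf => ?_).trans (Finset.card_union_le _ _)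
    rw [Finset.mem_filter] at hf
    rw [Finset.mem_union, hN, hP, Finset.mem_filter, Finset.mem_filter, Finset.mem_filter]
    rcases (hW f hf.1).or_of_mem hR hA hs.1 hg0 with hr | hr
    · rw [insert_empty_eq] at hr
      exact .inl ⟨⟨hf.1, hr⟩, hf.2⟩
    · rw [insert_empty_eq] at hr
      exact .inr ⟨hf.1, hr, hf.2⟩
  have h1 : G.missCount k φ v N (φ g) ≤ 2 :=
    h.missCount_le_two_of_avoid hV hE hdeg hdom hJE hA he he0 hd hdk
      fun f hf => (Finset.mem_filter.1 hf).2
  have hψ := h.shift hA he he0 hs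
  have hreach : ∀ f ∈ insert g P, G.FanReach k (Graph.shift φ e g) v A {φ g} g f := by
    intro f hf
    rcases Finset.mem_insert.1 hf with rfl | hf
    · exact .refl
    · exact ((Finset.mem_filter.1 hf).2.1.shift hA he hs.1 he0 hge rfl).1
  have hmiss : ∀ f ∈ insert g P,
      φ g ∈ G.missing k (Graph.shift φ e g) (G.farEnd v f) := by
    intro f hf
    rcases Finset.mem_insert.1 hf with rfl | hf
    · refine mem_missing.2 ⟨(mem_missing.1 hs.2.2).1, fun i hi hif => ?_⟩
      by_cases h2 : i = f
      · subst h2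
        rw [shift_right] at hif
        exact hg0 hif.symm
      by_cases h3 : i = e
      · subst h3
        rcases hi.eq_or_eq_of_isLink (hA.inc i he).isLink_farEnd with h4 | h4
        · exact hgv.isLink_farEnd.ne h4.symm
        · exact hge (hA.injOn_farEnd hs.1 he h4)
      · rw [shift_of_ne h3 h2] at hif
        exact h2 (hR.proper hi hgv.isLink_farEnd.inc_right hif (hif ▸ hg0))
    · obtain ⟨-, hr, hm⟩ := Finset.mem_filter.1 hf
      exact hA.missing_subset_shift he (hr.mem hs.1) (hr.shift hA he hs.1 he0 hge rfl).2 hm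
  have h2 := hψ.missCount_le_two_of_avoid hV hE hdeg hdom hJE hA hs.1 shift_right
    (fun j hj => by
      rw [shift_of_ne (by rintro rfl; exact hA.notMem _ he hj)
        (by rintro rfl; exact hA.notMem _ hs.1 hj)]
      exact hd j hj) hdk hreach
  rw [missCount, Finset.filter_true_of_mem hmiss, Finset.card_insert_of_notMem] at h2
  · omega
  · intro hgP
    exact (mem_missing.1 (Finset.mem_filter.1 hgP).2.2).2 g hgv.isLink_farEnd.inc_right rfl

/-- With four colors more than the maximum degree, an optimal coloring leaves no edge uncolored. -/
lemma IsOptimal.false_of_hasFanDomains [G.Loopless] (h : IsOptimal G J₀ k φ)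
    (hV : G.vertexSet.Finite) (hE : G.edgeSet.Finite) (hdeg : ∀ v, G.degree v + 4 ≤ k)
    (hdom : HasFanDomains G J₀) (hJE : J₀ ⊆ G.edgeSet) (hJk : J₀.ncard < k)
    (he : G.Inc e v) (he0 : φ e = 0) : False := by
  classical
  have hR := h.toIsRainbowPartial
  obtain ⟨A, hA, heA, hcard⟩ := hdom v e he fun hJ => h.colored e hJ he0
  -- a color that is absent from `J₀`
  obtain ⟨d, hdk, hd⟩ : ∃ d ∈ Set.Icc 1 k, ∀ j ∈ J₀, φ j ≠ d := by
    by_contra! hcon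
    have h1 : Set.Icc 1 k ⊆ φ '' J₀ := hcon
    have h2 := (Set.ncard_le_ncard h1 ((hE.subset hJE).image φ)).trans
      (Set.ncard_image_le (hE.subset hJE))
    rw [← Finset.coe_Icc, Set.ncard_coe_finset, Nat.card_Icc] at h2
    omega
  have hfin := finite_setOf_fanReach (k := k) (φ := φ) hE hA heA
  obtain ⟨W, hW⟩ : ∃ W : Finset β, ∀ f, f ∈ W ↔ G.FanReach k φ v A ∅ e f :=
    ⟨hfin.toFinset, by simp⟩
  have hDfin : ({f | G.Inc f v} \ A).Finite := hE.subset fun f hf => hf.1.edge_mem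
  obtain ⟨D, hD⟩ : ∃ D : Finset β, ∀ g, g ∈ D ↔ G.Inc g v ∧ g ∉ A := ⟨hDfin.toFinset, by simp⟩
  have hDcard : D.card ≤ 3 := by
    rw [← Set.ncard_coe_finset]
    convert hcard
    ext g
    simpa using hD g
  have heW : e ∈ W := (hW e).2 .refl
  have h1 := h.sum_card_missing_fan_le hE hA heA he0 hW hD
  set P : Finset β := {g ∈ W.erase e | φ g ∈ G.missing k φ (G.farEnd v e)} with hP
  have hsumD : ∑ g ∈ D, G.missCount k φ v W (φ g) ≤ D.card * 2 := by
    refine Finset.sum_le_card_nsmul D _ 2 fun g hg => ?_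
    refine h.missCount_le_two_of_avoid hV hE hdeg hdom hJE hA heA he0 hd hdk fun f hf => ?_
    -- no edge of the fan domain has the color of `g`, which lies outside of it
    have hr := (hW f).1 hf
    clear hf
    induction hr with
    | refl => exact .refl
    | @tail f f' _ hs ih =>
      refine ih.tail ⟨hs.1, fun hfg => ((hD g).1 hg).2 ?_, hs.2.2⟩
      rw [hR.proper ((hD g).1 hg).1 (hA.inc f' hs.1) (Set.mem_singleton_iff.1 hfg).symm
        (Set.mem_singleton_iff.1 hfg ▸ ne_zero_of_mem_missing hs.2.2)]
      exact hs.1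
  have hsumW : ∑ g ∈ W.erase e, G.missCount k φ v W (φ g) + P.card ≤ (W.erase e).card * 4 := by
    rw [hP, Finset.card_filter, ← Finset.sum_add_distrib]
    refine Finset.sum_le_card_nsmul _ _ 4 fun g hg => ?_
    split_ifs with hm
    · have := h.missCount_le_three hV hE hdeg hdom hJE hA heA he0 hd hdk (fun f => (hW f).1)
        ⟨((hW g).1 (Finset.mem_of_mem_erase hg)).mem heA, Set.notMem_empty _, hm⟩
      omega
    · exact h.missCount_le_four hV hE hdeg hdom hJE hA heA he0 hd hdk (fun f => (hW f).1)
  have hPcard : (G.missing k φ (G.farEnd v e)).card ≤ P.card + D.card := by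
    refine (Finset.card_le_card (t := (P ∪ D).image φ) fun c hc => ?_).trans
      (Finset.card_image_le.trans (Finset.card_union_le _ _))
    obtain ⟨g, hg1, rfl, hge, hg⟩ := h.exists_of_mem_missing_farEnd hE hA heA he0 .refl hc
    refine Finset.mem_image_of_mem _ (Finset.mem_union.2 ?_)
    by_cases hgA : g ∈ A
    · exact .inl (Finset.mem_filter.2 ⟨Finset.mem_erase.2 ⟨hge, (hW g).2 (hg hgA)⟩, hc⟩)
    · exact .inr ((hD g).2 ⟨hg1, hgA⟩)
  have hme : 5 ≤ (G.missing k φ (G.farEnd v e)).card := by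
    have h2 := lt_card_missing_add_degree (k := k) hE he.isLink_farEnd.inc_right he0
    have h3 := hdeg (G.farEnd v e)
    omega
  have hlow : (W.erase e).card * 4 + 5 ≤ ∑ f ∈ W, (G.missing k φ (G.farEnd v f)).card := by
    rw [← Finset.add_sum_erase _ _ heW]
    have h2 := Finset.card_nsmul_le_sum (W.erase e)
      (fun f => (G.missing k φ (G.farEnd v f)).card) 4 fun f _ => by
        have h3 := le_card_missing_add_degree (k := k) hE φ (G.farEnd v f)
        have h4 := hdeg (G.farEnd v f)
        omega
    simp only [smul_eq_mul] at h2
    omega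
  omega

/-! ### From the hypotheses on the multigraph to an edge coloring -/

lemma degree_le_maxDegree (hV : G.vertexSet.Finite) (v : α) : G.degree v ≤ G.maxDegree := by
  by_cases hv : v ∈ G.vertexSet
  · exact le_csSup (hV.image _).bddAbove ⟨v, hv, rfl⟩
  · have : {e | G.Inc e v} = ∅ := Set.eq_empty_of_forall_notMem fun e he => hv he.vertex_mem
    simp [degree, this]

lemma edgeCount_le_multiplicity (hV : G.vertexSet.Finite) (hu : u ∈ G.vertexSet)
    (hv : v ∈ G.vertexSet) : G.edgeCount u v ≤ G.multiplicity :=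
  (le_csSup (hV.image fun u => G.edgeCount u v).bddAbove ⟨u, hu, rfl⟩ :
    _ ≤ G.vertexMultiplicity v).trans (le_csSup (hV.image _).bddAbove ⟨v, hv, rfl⟩)

lemma IsRainbowPartial.exists_isOptimal (h : IsRainbowPartial G J₀ k φ) :
    ∃ ψ, IsOptimal G J₀ k ψ := by
  classical
  have hex : ∃ n, ∃ ψ, IsRainbowPartial G J₀ k ψ ∧ (G.uncolored ψ).ncard = n := ⟨_, φ, h, rfl⟩
  obtain ⟨ψ, hψ, hn⟩ := Nat.find_spec hex
  exact ⟨ψ, hψ, fun ψ' hψ' => hn ▸ Nat.find_min' hex ⟨ψ', hψ', rfl⟩⟩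

lemma IsEdgeColoring.exists_isRainbowPartial {k₀ : ℕ} (h : (G.restrict J).IsEdgeColoring k₀ φ)
    (hinj : Set.InjOn φ J₀) (hJ₀ : J₀ ⊆ J) (hJ : J ⊆ G.edgeSet) (hk : k₀ ≤ k) :
    ∃ ψ, IsRainbowPartial G J₀ k ψ := by
  classical
  have hE : ∀ e ∈ J, e ∈ (G.restrict J).edgeSet := fun e he => by simp [hJ he, he]
  have hin : ∀ e ∈ J, (if e ∈ J then φ e else 0) = φ e := fun e he => if_pos he
  refine ⟨fun e => if e ∈ J then φ e else 0, fun e _ => ?_, fun e f v he hf hef he0 => ?_,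
    fun e he => ?_, hinj.congr fun e he => (hin e (hJ₀ he)).symm⟩
  · split_ifs with heJ
    · exact (h.1 e (hE e heJ)).2.trans hk
    · exact Nat.zero_le _
  · have heJ : e ∈ J := by by_contra h; simp [h] at he0
    have hfJ : f ∈ J := by by_contra h; rw [hef] at he0; simp [h] at he0
    by_contra hne
    simp only [hin e heJ, hin f hfJ] at hef
    exact h.2 e (hE e heJ) f (hE f hfJ) v (restrict_inc.2 ⟨he, heJ⟩) (restrict_inc.2 ⟨hf, hfJ⟩)
      hne hef
  · simp only [hin e (hJ₀ he)]
    have := (h.1 e (hE e (hJ₀ he))).1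
    omega

lemma IsRainbowPartial.isEdgeColoring (h : IsRainbowPartial G J₀ k φ)
    (h0 : ∀ e ∈ G.edgeSet, φ e ≠ 0) : G.IsEdgeColoring k φ :=
  ⟨fun e he => ⟨Nat.one_le_iff_ne_zero.2 (h0 e he), h.le e he⟩,
    fun e he _ _ _ hev hfv hne hef => hne (h.proper hev hfv hef (h0 e he))⟩

/-- At a vertex `v ≠ x`, it suffices to leave out of a fan domain at most one edge of the matching,
and the edges to `x`, and one edge of a pair of parallel edges to another vertex. In the presence of
the last, there is only one edge to `x`. -/
lemma hasFanDomains (hV : G.vertexSet.Finite) (hE : G.edgeSet.Finite) (hμ : G.multiplicity ≤ 2)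
    (hx : x ∈ G.vertexSet)
    (hdouble : ∀ u ∈ G.vertexSet, u ≠ x → ∀ v ∈ G.vertexSet, ∀ w ∈ G.vertexSet,
      G.edgeCount u v = 2 → G.edgeCount u w = 2 → v = w)
    (hM : G.IsEdgeMatching M) (hJ₀ : J₀ = M ∪ {e | G.Inc e x}) : HasFanDomains G J₀ := by
  intro v e hev heJ
  have hxJ : ∀ f, G.Inc f x → f ∈ J₀ := fun f hf => hJ₀ ▸ .inr hf
  have hv : v ∈ G.vertexSet := hev.vertex_mem
  have hvx : v ≠ x := by rintro rfl; exact heJ (hxJ e hev)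
  have hfin : ∀ P : β → Prop, {f | G.Inc f v ∧ P f}.Finite :=
    fun P => hE.subset fun f hf => hf.1.edge_mem
  have hlfin : ∀ w, {f | G.IsLink f v w}.Finite := fun w => hE.subset fun f hf => hf.edge_mem
  have hcount : ∀ w ∈ G.vertexSet, G.edgeCount v w ≤ 2 :=
    fun w hw => (edgeCount_le_multiplicity hV hv hw).trans hμ
  have heq : ∀ w ∈ G.vertexSet, G.edgeCount v w ≠ 2 → ∀ f g, G.IsLink f v w → G.IsLink g v w →
      f = g := by
    intro w hw h2 f g hf hg
    have h1 := hcount w hw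
    exact (Set.ncard_le_one (hlfin w)).1 (show G.edgeCount v w ≤ 1 by omega) f hf g hg
  have hM1 : {f | G.Inc f v ∧ f ∈ M}.ncard ≤ 1 :=
    (Set.ncard_le_one (hfin _)).2 fun f hf g hg => hM.2 f hf.2 g hg.2 v hf.1 hg.1
  have hsub : ∀ f, G.Inc f v → f ∈ J₀ → f ∈ {f | G.Inc f v ∧ f ∈ M} ∪ {f | G.IsLink f v x} := by
    intro f hf hfJ
    rw [hJ₀] at hfJ
    refine hfJ.imp (fun hfM => ⟨hf, hfM⟩) fun hfx => ?_
    obtain ⟨y, hy⟩ := hf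
    obtain rfl := Inc.eq_of_isLink_of_ne_left hfx hy hvx.symm
    exact hy
  by_cases hd : ∃ w ∈ G.vertexSet, w ≠ x ∧ G.edgeCount v w = 2
  · obtain ⟨w, hw, hwx, hw2⟩ := hd
    obtain ⟨d, hdw, hde⟩ : ∃ d ∈ {f | G.IsLink f v w}, d ≠ e :=
      Set.exists_ne_of_one_lt_ncard (show 1 < G.edgeCount v w by omega) e
    refine ⟨{f | G.Inc f v ∧ f ∉ J₀ ∧ f ≠ d}, ⟨fun f hf => hf.1, fun f hf => hf.2.1, ?_⟩,
      ⟨hev, heJ, hde.symm⟩, ?_⟩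
    · intro f hf g hg w' hfw hgw
      by_contra hne
      have hw'2 : G.edgeCount v w' = 2 := by
        by_contra h2
        exact hne (heq w' hfw.right_mem h2 f g hfw hgw)
      obtain rfl := hdouble v hv hvx w' hfw.right_mem w hw hw'2 hw2
      have h3 : 2 < {f | G.IsLink f v w'}.ncard :=
        (Set.two_lt_ncard (hlfin w')).2 ⟨f, hfw, g, hgw, d, hdw, hne, hf.2.2, hg.2.2⟩
      have h4 : {f | G.IsLink f v w'}.ncard = 2 := hw2
      omega
    · have hx1 : {f | G.IsLink f v x}.ncard ≤ 1 := by
        have h1 := hcount x hx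
        have h2 : G.edgeCount v x ≠ 2 := fun h => hwx (hdouble v hv hvx w hw x hx hw2 h)
        show G.edgeCount v x ≤ 1
        omega
      have h3 : {f | G.Inc f v} \ {f | G.Inc f v ∧ f ∉ J₀ ∧ f ≠ d} ⊆
          insert d ({f | G.Inc f v ∧ f ∈ M} ∪ {f | G.IsLink f v x}) := by
        rintro f ⟨hf, hfA⟩
        by_cases hfd : f = d
        · exact .inl hfd
        · exact .inr (hsub f hf (by by_contra h; exact hfA ⟨hf, h, hfd⟩))
      have h4 := Set.ncard_le_ncard h3 (((hfin _).union (hlfin x)).insert d)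
      have h5 := Set.ncard_insert_le d ({f | G.Inc f v ∧ f ∈ M} ∪ {f | G.IsLink f v x})
      have h6 := Set.ncard_union_le {f | G.Inc f v ∧ f ∈ M} {f | G.IsLink f v x}
      omega
  · push Not at hd
    refine ⟨{f | G.Inc f v ∧ f ∉ J₀}, ⟨fun f hf => hf.1, fun f hf => hf.2, ?_⟩, ⟨hev, heJ⟩, ?_⟩
    · intro f hf g _ w hfw hgw
      refine heq w hfw.right_mem (hd w hfw.right_mem ?_) f g hfw hgw
      rintro rfl
      exact hf.2 (hxJ f hfw.inc_right)
    · have hx2 : {f | G.IsLink f v x}.ncard ≤ 2 := hcount x hx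
      have h3 : {f | G.Inc f v} \ {f | G.Inc f v ∧ f ∉ J₀} ⊆
          {f | G.Inc f v ∧ f ∈ M} ∪ {f | G.IsLink f v x} := by
        rintro f ⟨hf, hfA⟩
        exact hsub f hf (by by_contra h; exact hfA ⟨hf, h⟩)
      have h4 := Set.ncard_le_ncard h3 ((hfin _).union (hlfin x))
      have h6 := Set.ncard_union_le {f | G.Inc f v ∧ f ∈ M} {f | G.IsLink f v x}
      omega

lemma isFanDomain_of_simple (hs : (G.deleteVerts {x}).Simple) (hxJ : ∀ e, G.Inc e x → e ∈ J₀)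
    (hvx : v ≠ x) : IsFanDomain G J₀ v {f | G.Inc f v ∧ f ∉ J₀} := by
  refine ⟨fun f hf => hf.1, fun f hf => hf.2, fun f hf g hg w hfw hgw => ?_⟩
  have hwx : w ≠ x := by
    rintro rfl
    exact hf.2 (hxJ f hfw.inc_right)
  exact IsLink.eq (G := G.deleteVerts {x}) (u := v) (v := w)
    ((deleteVerts_isLink ..).2 ⟨hfw, hvx, hwx⟩) ((deleteVerts_isLink ..).2 ⟨hgw, hvx, hwx⟩)

end Graph

theorem lemma13 {α β : Type*} (G : Graph α β) [G.Loopless]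
    (hV : G.vertexSet.Finite) (hE : G.edgeSet.Finite)
    (hμ : G.multiplicity ≤ 2)
    (x : α) (hx : x ∈ G.vertexSet)
    (hdouble : ∀ u ∈ G.vertexSet, u ≠ x → ∀ v ∈ G.vertexSet, ∀ w ∈ G.vertexSet,
      G.edgeCount u v = 2 → G.edgeCount u w = 2 → v = w)
    (M J₀ J : Set β)
    (hM : G.IsEdgeMatching M) (hMx : Disjoint M {e | G.Inc e x})
    (hJ₀ : J₀ = M ∪ {e | G.Inc e x})
    (hJ₀J : J₀ ⊆ J) (hJ : J ⊆ G.edgeSet)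
    (hsimple : (G.deleteEdges J).Simple)
    (k₀ : ℕ) (hk₀ : k₀ ≤ G.maxDegree) (hJ₀k₀ : J₀.ncard ≤ k₀)
    (φ₀ : β → ℕ) (hφ₀ : (G.restrict J).IsEdgeColoring k₀ φ₀) (hφ₀J₀ : Set.InjOn φ₀ J₀) :
    (∀ k : ℕ, G.maxDegree + 4 ≤ k →
      ∃ φ : β → ℕ, G.IsEdgeColoring k φ ∧ Set.InjOn φ J₀) ∧
    (∀ X Y : Set α,
      (∀ u ∈ G.vertexSet, u ≠ x → ∀ e ∈ J₀, ∀ f ∈ J₀, G.Inc e u → G.Inc f u → e = f) →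
      (G.deleteVerts {x}).Simple → (G.deleteVerts {x}).IsBipartition X Y →
      ((G.restrict J).deleteVerts {x}).maxDegree ≤ 1 →
      ∀ k : ℕ, G.maxDegree ≤ k → (∀ v ∈ X, G.degree v < k) →
        ∃ φ : β → ℕ, G.IsEdgeColoring k φ ∧ Set.InjOn φ J₀) := by
  obtain ⟨ψ₀, hψ₀⟩ : ∃ ψ, Graph.IsRainbowPartial G J₀ G.maxDegree ψ :=
    hφ₀.exists_isRainbowPartial hφ₀J₀ hJ₀J hJ hk₀
  have hxJ : ∀ e, G.Inc e x → e ∈ J₀ := fun e he => hJ₀ ▸ .inr he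
  have hopt : ∀ k, G.maxDegree ≤ k → ∃ φ, Graph.IsOptimal G J₀ k φ := fun k hk =>
    Graph.IsRainbowPartial.exists_isOptimal (φ := ψ₀)
      ⟨fun e he => (hψ₀.le e he).trans hk, hψ₀.proper, hψ₀.colored, hψ₀.injOn⟩
  refine ⟨fun k hk => ?_, fun X Y hJdeg hs hbip _ k hk hXdeg => ?_⟩
  · obtain ⟨φ, hφ⟩ := hopt k (by omega)
    refine ⟨φ, hφ.isEdgeColoring fun e he he0 => ?_, hφ.injOn⟩
    obtain ⟨v, w, hvw⟩ := Graph.exists_isLink_of_mem_edgeSet he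
    refine hφ.false_of_hasFanDomains hV hE (fun v => ?_)
      (Graph.hasFanDomains hV hE hμ hx hdouble hM hJ₀) (hJ₀J.trans hJ) (by omega) hvw.inc_left he0
    have := Graph.degree_le_maxDegree hV v
    omega
  · obtain ⟨φ, hφ⟩ := hopt k hk
    refine ⟨φ, hφ.isEdgeColoring fun e he he0 => ?_, hφ.injOn⟩
    obtain ⟨hVXY, hdisj, hlink⟩ := hbip
    have hxXY : x ∉ X ∪ Y := by
      rw [hVXY, Graph.vertexSet_deleteVerts]
      exact fun h => h.2 rfl
    have hl : ∀ e u w, G.IsLink e u w → u ≠ x → w ≠ x → (u ∈ X ∧ w ∈ Y) ∨ (u ∈ Y ∧ w ∈ X) :=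
      fun e u w h hu hw => hlink e u w ((Graph.deleteVerts_isLink ..).2 ⟨h, hu, hw⟩)
    have heJ : e ∉ J₀ := fun h => hφ.colored e h he0
    have hne : ∀ u, G.Inc e u → u ≠ x := by
      rintro u hu rfl
      exact heJ (hxJ e hu)
    obtain ⟨v, hvY, hev⟩ : ∃ v ∈ Y, G.Inc e v := by
      obtain ⟨u, w, huw⟩ := Graph.exists_isLink_of_mem_edgeSet he
      rcases hl e u w huw (hne u huw.inc_left) (hne w huw.inc_right) with h | h
      · exact ⟨w, h.2, huw.inc_right⟩
      · exact ⟨u, h.1, huw.inc_left⟩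
    refine hφ.false_of_bipartite hV hE (Graph.isFanDomain_of_simple hs hxJ (hne v hev))
      ⟨hev, heJ⟩ he0
      (fun e u w h hu hw huX => (hl e u w h hu hw).elim (fun h => h.2)
        fun h => absurd h.1 (Set.disjoint_left.1 hdisj huX))
      (fun e u w h hu hw huY => (hl e u w h hu hw).elim
        (fun h => absurd huY (Set.disjoint_left.1 hdisj h.1)) fun h => h.2)
      hdisj (fun h => hxXY (.inl h)) (fun h => hxXY (.inr h)) hxJ hvY ?_
      ((Graph.degree_le_maxDegree hV v).trans hk) hXdeg
    refine (Set.ncard_le_one (hE.subset fun f hf => hf.1.edge_mem)).2 fun f hf g hg => ?_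
    have hJ' : ∀ f, f ∈ {f | G.Inc f v} \ {f | G.Inc f v ∧ f ∉ J₀} → f ∈ J₀ :=
      fun f hf => by_contra fun h => hf.2 ⟨hf.1, h⟩
    exact hJdeg v hev.vertex_mem (hne v hev) f (hJ' f hf) g (hJ' g hg) hf.1 hg.1
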